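/- Let $k,l\ge 0$, let $\mu_1,\dots,\mu_k\ge 0$ and $m_1,\dots,m_l$ be real numbers, and let $M=\mathbb{R}^{2+k+l}$, with global coordinates $(x^+,x^-,x_i,y_a)$, be the homogeneous plane wave with metric $$ds^2=-2\,dx^+dx^- -\Big(\sum_{i=1}^k\mu_i^2x_i^2-\sum_{a=1}^l m_a^2y_a^2\Big)(dx^+)^2+\sum_i dx_i^2+\sum_a dy_a^2 ,$$ time-oriented so that $x^+$ increases along future-directed timelike curves. Let $\ll$ be its chronology relation ($p\ll q$ if there is a future-directed piecewise $C^1$ timelike curve from $p$ to $q$), and $I^\pm$ the corresponding chronological futures and pasts. Completion. A past set is a set of the form $I^-[S]$; an IP is a nonempty past set that is not the union of two proper subsets that are past sets; future sets and IFs are defined dually. Put $\uparrow\! P=I^+[\{q: p\ll q\ \forall p\in P\}]$ and $\downarrow\! F=I^-[\{p: p\ll q\ \forall q\in F\}]$. An IP $P$ and an IF $F$ are related if $P$ is a maximal IP contained in $\downarrow\! F$ and $F$ is a maximal IF contained in $\uparrow\! P$. The Marolf--Ross causal completion $\bar M$ is the set of all related pairs $(P,F)$, together with the pairs $(P,\emptyset)$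 and $(\emptyset,F)$ for those IPs $P$ and IFs $F$ that occur in no related pair. A point $p\in M$ is represented by $(I^-(p),I^+(p))$; elements of $\bar M$ that represent no point of $M$ are called ideal points. Topology. For $\bar S\subset\bar M$ let $L^+(\bar S)=\mathrm{Cl}_{FB}(\bar S\cup\{(P,F)\in\bar M: \emptyset\ne F\subset\bigcup_{(P',F')\in\bar S}F'\})$, where $\mathrm{Cl}_{FB}(\bar A)$ adds to $\bar A$ all $(P,\emptyset)\in\bar M$ for which there are $(P_n,F_n)\in\bar A$ with $P_n\to P$, i.e. every $x\in P$ lies in $P_n$ for all large $n$ and every $x\notin\mathrm{Cl}\,P$ lies outside $\mathrm{Cl}\,P_n$ for all large $n$. Define $L^-(\bar S)$ dually. The topology $\bar{\mathcal T}$ is the coarsest one in which all sets $L^\pm(\bar S)$ are closed. Suppose that $M$ satisfies the null convergence condition ($\mathrm{Ric}(v,v)\ge 0$ for every null vector $v$) and is not conformally flat (i.e. not locally conformal to Minkowski space). Then $(\bar M,\bar{\mathcal T})$ is not compact. Moreover, let $i,j$ be indices with $\mu_j<\mu_i$ and let $\bar S\subset\bar M$ be the image of the spacelike line on which all coordinates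 except $x_j$ vanish. Then no ideal point lies in $L^+(\bar S)\cap L^-(\bar S)$. Further, if $A\subset\mathbb{R}$ has no accumulation point in $\mathbb{R}$, the set of points of $\bar M$ representing the points of the line with $x_j\in A$ has no accumulation point in $(\bar M,\bar{\mathcal T})$, and this set is infinite if $A$ is infinite. -/

import Mathlib

open Set Filter Topology
open scoped ContDiff

/-! ## Lorentzian geometry in global coordinates

A metric on the coordinate space `ι → ℝ` is given by its component matrix at each point. -/

section Metric

/-- A field of symmetric bilinear forms on `ι → ℝ`, given by its components. -/
abbrev MetricField (ι : Type) : Type := (ι → ℝ) → Matrix ι ι ℝ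

/-- The number `g_p(v, w)`. -/
def MetricField.pair {ι : Type} [Fintype ι] (g : MetricField ι) (p v w : ι → ℝ) : ℝ :=
  ∑ i, ∑ j, g p i j * v i * w j

/-- The partial derivative `∂_i f` at `p`. -/
noncomputable def partialDeriv {ι : Type} [Fintype ι] [DecidableEq ι] (i : ι)
    (f : (ι → ℝ) → ℝ) (p : ι → ℝ) : ℝ :=
  fderiv ℝ f p (Pi.single i 1)

/-- The Christoffel symbol `Γ^a_{bc}` at `p`. -/
noncomputable def MetricField.christoffel {ι : Type} [Fintype ι] [DecidableEq ι]
    (g : MetricField ι) (a b c : ι) (p : ι → ℝ) : ℝ :=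
  (1 / 2) * ∑ d, (g p)⁻¹ a d *
    (partialDeriv b (fun x => g x d c) p + partialDeriv c (fun x => g x d b) p
      - partialDeriv d (fun x => g x b c) p)

/-- The component `R_{bc}` of the Ricci tensor at `p`, with the sign for which round spheres
have positive Ricci curvature. -/
noncomputable def MetricField.ricci {ι : Type} [Fintype ι] [DecidableEq ι]
    (g : MetricField ι) (b c : ι) (p : ι → ℝ) : ℝ :=
  ∑ a, (partialDeriv a (g.christoffel a b c) p - partialDeriv c (g.christoffel a b a) p)
    + ∑ a, ∑ d, (g.christoffel a a d p * g.christoffel d b c p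
      - g.christoffel a c d p * g.christoffel d b a p)

/-- The null convergence condition: `Ric(v, v) ≥ 0` for every null vector `v`. -/
def MetricField.NullConvergence {ι : Type} [Fintype ι] [DecidableEq ι]
    (g : MetricField ι) : Prop :=
  ∀ p v : ι → ℝ, g.pair p v v = 0 → 0 ≤ ∑ b, ∑ c, g.ricci b c p * v b * v c

/-- `g` is locally conformal to `η`: around each point there are a smooth map `φ` and a smooth
positive function `Ω` with `g = Ω² φ^* η`.  (For nondegenerate `g` such a `φ` is
automatically a local diffeomorphism.) -/
def MetricField.LocallyConformalTo {ι : Type} [Fintype ι] (g η : MetricField ι) : Prop :=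
  ∀ p : ι → ℝ, ∃ (U : Set (ι → ℝ)) (φ : (ι → ℝ) → (ι → ℝ)) (Ω : (ι → ℝ) → ℝ),
    IsOpen U ∧ p ∈ U ∧ ContDiffOn ℝ ∞ φ U ∧ ContDiffOn ℝ ∞ Ω U ∧
    ∀ x ∈ U, 0 < Ω x ∧
      ∀ v w : ι → ℝ, g.pair x v w = Ω x ^ 2 * η.pair (φ x) (fderiv ℝ φ x v) (fderiv ℝ φ x w)

/-- `v` is timelike at `p`, and future-directed for the time orientation in which the nowhere
zero causal vector field `T` is future-directed. -/
def MetricField.FutureTimelike {ι : Type} [Fintype ι] (g : MetricField ι)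
    (T : (ι → ℝ) → (ι → ℝ)) (p v : ι → ℝ) : Prop :=
  g.pair p v v < 0 ∧ g.pair p (T p) v < 0

/-- There is a future-directed timelike `C¹` curve from `p` to `q`. -/
def MetricField.TimelikeCurve {ι : Type} [Fintype ι] (g : MetricField ι)
    (T : (ι → ℝ) → (ι → ℝ)) (p q : ι → ℝ) : Prop :=
  ∃ γ γ' : ℝ → (ι → ℝ), γ 0 = p ∧ γ 1 = q ∧ ContinuousOn γ' (Icc 0 1) ∧
    ∀ t ∈ Icc (0 : ℝ) 1, HasDerivWithinAt γ (γ' t) (Icc 0 1) t ∧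
      g.FutureTimelike T (γ t) (γ' t)

/-- The chronology relation `p ≪ q`: there is a future-directed, piecewise `C¹` timelike curve
from `p` to `q`, that is, a finite chain of `C¹` ones. -/
def MetricField.Chron {ι : Type} [Fintype ι] (g : MetricField ι)
    (T : (ι → ℝ) → (ι → ℝ)) : (ι → ℝ) → (ι → ℝ) → Prop :=
  Relation.TransGen (g.TimelikeCurve T)

end Metric

/-! ## The causal completion by IP-IF pairs -/

section Completion

/-- The chronological past `I⁻[S]`, where `R p q` stands for `p ≪ q`. -/
def chronPast {X : Type} (R : X → X → Prop) (S : Set X) : Set X := {x | ∃ s ∈ S, R x s}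

/-- The chronological future `I⁺[S]`. -/
def chronFuture {X : Type} (R : X → X → Prop) (S : Set X) : Set X := {x | ∃ s ∈ S, R s x}

/-- `P` is a past set. -/
def IsPastSet {X : Type} (R : X → X → Prop) (P : Set X) : Prop := ∃ S, P = chronPast R S

/-- `F` is a future set. -/
def IsFutureSet {X : Type} (R : X → X → Prop) (F : Set X) : Prop := ∃ S, F = chronFuture R S

/-- Indecomposable past sets (IPs): nonempty past sets that are not the union of two proper
subsets which are past sets. -/
def IsIP {X : Type} (R : X → X → Prop) (P : Set X) : Prop :=
  P.Nonempty ∧ IsPastSet R P ∧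
    ∀ P₁ P₂, IsPastSet R P₁ → IsPastSet R P₂ → P = P₁ ∪ P₂ → P₁ = P ∨ P₂ = P

/-- Indecomposable future sets (IFs). -/
def IsIF {X : Type} (R : X → X → Prop) (F : Set X) : Prop :=
  F.Nonempty ∧ IsFutureSet R F ∧
    ∀ F₁ F₂, IsFutureSet R F₁ → IsFutureSet R F₂ → F = F₁ ∪ F₂ → F₁ = F ∨ F₂ = F

/-- The (open) common past `↓F`. -/
def commonPast {X : Type} (R : X → X → Prop) (F : Set X) : Set X :=
  chronPast R {p | ∀ q ∈ F, R p q}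

/-- The (open) common future `↑P`. -/
def commonFuture {X : Type} (R : X → X → Prop) (P : Set X) : Set X :=
  chronFuture R {q | ∀ p ∈ P, R p q}

/-- The Szabados relation between an IP `P` and an IF `F`: `P` is a maximal IP inside `↓F`, and
`F` is a maximal IF inside `↑P`. -/
def SRelated {X : Type} (R : X → X → Prop) (P F : Set X) : Prop :=
  (IsIP R P ∧ P ⊆ commonPast R F ∧
    ∀ P', IsIP R P' → P ⊆ P' → P' ⊆ commonPast R F → P' = P) ∧
  (IsIF R F ∧ F ⊆ commonFuture R P ∧
    ∀ F', IsIF R F' → F ⊆ F' → F' ⊆ commonFuture R P → F' = F)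

/-- The pairs that make up the causal completion: related IP-IF pairs, and pairs `(P, ∅)`,
`(∅, F)` for each IP `P` and each IF `F` that occurs in no related pair. -/
def IsCompletionPair {X : Type} (R : X → X → Prop) (P F : Set X) : Prop :=
  SRelated R P F ∨
  (IsIP R P ∧ F = ∅ ∧ ∀ F', ¬ SRelated R P F') ∨
  (P = ∅ ∧ IsIF R F ∧ ∀ P', ¬ SRelated R P' F)

/-- The Marolf-Ross causal completion. -/
structure CausalCompletion {X : Type} (R : X → X → Prop) : Type where
  past : Set X
  future : Set X
  isPair : IsCompletionPair R past future

/-- `Q` is the point `(I⁻(p), I⁺(p))` of the completion that represents `p`. -/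
def CausalCompletion.Represents {X : Type} {R : X → X → Prop} (Q : CausalCompletion R)
    (p : X) : Prop :=
  Q.past = chronPast R {p} ∧ Q.future = chronFuture R {p}

/-- Ideal points: those that represent no point of the spacetime. -/
def CausalCompletion.IsIdeal {X : Type} {R : X → X → Prop} (Q : CausalCompletion R) : Prop :=
  ∀ p, ¬ Q.Represents p

/-- The image in the completion of a set of spacetime points. -/
def CausalCompletion.pts {X : Type} (R : X → X → Prop) (S : Set X) :
    Set (CausalCompletion R) :=
  {Q | ∃ p ∈ S, Q.Represents p}

/-- Convergence of a sequence of past (or future) sets `A n` to `B`. -/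
def SetsConverge {X : Type} [TopologicalSpace X] (A : ℕ → Set X) (B : Set X) : Prop :=
  (∀ x ∈ B, ∀ᶠ n in atTop, x ∈ A n) ∧ (∀ x ∉ closure B, ∀ᶠ n in atTop, x ∉ closure (A n))

namespace CausalCompletion

/-- The points with nonempty future contained in the future of `S`. -/
def LIF {X : Type} {R : X → X → Prop} (S : Set (CausalCompletion R)) :
    Set (CausalCompletion R) :=
  {P | P.future.Nonempty ∧ P.future ⊆ ⋃ Q ∈ S, Q.future}

/-- The points with nonempty past contained in the past of `S`. -/
def LIP {X : Type} {R : X → X → Prop} (S : Set (CausalCompletion R)) :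
    Set (CausalCompletion R) :=
  {P | P.past.Nonempty ∧ P.past ⊆ ⋃ Q ∈ S, Q.past}

/-- Closure on the future boundary: adjoin the points with empty future whose past is the limit
of the pasts of a sequence in `S`. -/
def closureFB {X : Type} [TopologicalSpace X] {R : X → X → Prop}
    (S : Set (CausalCompletion R)) : Set (CausalCompletion R) :=
  S ∪ {P | P.future = ∅ ∧ ∃ s : ℕ → CausalCompletion R,
    (∀ n, s n ∈ S) ∧ SetsConverge (fun n => (s n).past) P.past}

/-- Closure on the past boundary. -/
def closurePB {X : Type} [TopologicalSpace X] {R : X → X → Prop}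
    (S : Set (CausalCompletion R)) : Set (CausalCompletion R) :=
  S ∪ {P | P.past = ∅ ∧ ∃ s : ℕ → CausalCompletion R,
    (∀ n, s n ∈ S) ∧ SetsConverge (fun n => (s n).future) P.future}

/-- The set `L⁺(S)`. -/
def Lplus {X : Type} [TopologicalSpace X] {R : X → X → Prop}
    (S : Set (CausalCompletion R)) : Set (CausalCompletion R) :=
  closureFB (S ∪ LIF S)

/-- The set `L⁻(S)`. -/
def Lminus {X : Type} [TopologicalSpace X] {R : X → X → Prop}
    (S : Set (CausalCompletion R)) : Set (CausalCompletion R) :=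
  closurePB (S ∪ LIP S)

/-- The Marolf-Ross topology: the coarsest one in which all `L⁺(S)` and `L⁻(S)` are closed. -/
instance instTopologicalSpace {X : Type} [TopologicalSpace X] {R : X → X → Prop} :
    TopologicalSpace (CausalCompletion R) :=
  TopologicalSpace.generateFrom {U | ∃ S, U = (Lplus S)ᶜ ∨ U = (Lminus S)ᶜ}

end CausalCompletion

end Completion

/-! ## Homogeneous plane waves -/

section PlaneWave

/-- The index set of the global coordinates `(x⁺, x⁻, x^i, y^a)`. -/
abbrev PWCoord (k l : ℕ) : Type := Fin 2 ⊕ (Fin k ⊕ Fin l)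

/-- The quadratic form `∑ μ_i² x_i² - ∑ m_a² y_a²`. -/
def pwPotential {k l : ℕ} (μ : Fin k → ℝ) (m : Fin l → ℝ) (p : PWCoord k l → ℝ) : ℝ :=
  ∑ i, μ i ^ 2 * p (Sum.inr (Sum.inl i)) ^ 2 - ∑ a, m a ^ 2 * p (Sum.inr (Sum.inr a)) ^ 2

/-- The metric `-2 dx⁺ dx⁻ - (∑ μ_i² x_i² - ∑ m_a² y_a²) (dx⁺)² + dx^i dx^i + dy^a dy^a`. -/
def planeWave {k l : ℕ} (μ : Fin k → ℝ) (m : Fin l → ℝ) : MetricField (PWCoord k l) :=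
  fun p => Matrix.fromBlocks !![-pwPotential μ m p, -1; -1, 0] 0 0 1

/-- The Minkowski metric `-2 dx⁺ dx⁻ + dx^i dx^i + dy^a dy^a` in light-cone coordinates. -/
def minkowski (k l : ℕ) : MetricField (PWCoord k l) :=
  fun _ => Matrix.fromBlocks !![0, -1; -1, 0] 0 0 1

/-- The chronology relation of the plane wave, time-oriented by the null vector field `∂/∂x⁻`;
a timelike vector is then future-directed exactly when its `x⁺`-component is positive. -/
def planeWaveChron {k l : ℕ} (μ : Fin k → ℝ) (m : Fin l → ℝ) :
    (PWCoord k l → ℝ) → (PWCoord k l → ℝ) → Prop :=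
  (planeWave μ m).Chron (fun _ => Pi.single (Sum.inl 1) 1)

/-- The point whose only possibly nonzero coordinate is `x_j = t`. -/
def xAxisPoint {k l : ℕ} (j : Fin k) (t : ℝ) : PWCoord k l → ℝ :=
  Pi.single (Sum.inr (Sum.inl j)) t

end PlaneWave

/-! Let `ν ^ 2` be the largest of the signed squared frequencies `freq`. At the origin the Ricci
component in the direction of the null vector `∂/∂x⁺` is the sum of the frequencies, so null
convergence makes this sum nonnegative. If all frequencies agree, Rosen coordinates exhibit the
metric as conformally flat. Hence the hypotheses force `ν > 0` and some mode `j` with frequency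
strictly below `ν ^ 2` (`exists_freq_lt`).

The chronology relation is controlled by the focusing time `π / ν`. Over shorter `x⁺`-intervals it
is the explicit inequality `∑ (ΔZ)² / ΔT < 2 ΔV` in Rosen coordinates (`rosenQ_lt_of_chron`,
`chron_of_rosenQ_lt`). Over longer ones it always holds, because oscillation in the strongest mode
makes the action arbitrarily negative (`chron_of_long`). It follows that an IP on which `x⁺` is
bounded above is either some `I⁻(p)` or a half-space `x⁺ < c` (`isIP_eq_of_bounded`), and that the
half-space `x⁺ > c` is paired with `x⁺ < c - π / ν` (`sRelated_halfSpaces`).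

Suppose a completion point lies in both limit sets of a closed part of the `z_j`-axis and is not
already one of its points. One of its components is nonempty; up to time reversal, let it be the
future. If that is `I⁺(q)`, then comparing futures and pasts puts `q` on the axis. Otherwise the
pair consists of half-spaces. The future of the axis contains `x⁺ > c` only if `c ≥ w` for some `w >
π / (2 ν)`, since mode `j` focuses later than the strongest one; dually `π / ν - c ≥ w`. The sum is
`2 w ≤ π / ν`, which is impossible (`mem_axisPts_of_future`).

Thus closed parts of the axis have closed image, so a subset of the axis without accumulation points
acquires none in the completion. Applied to the natural numbers, this excludes compactness. -/

/-! ## Coordinates on plane waves -/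

namespace PlaneWave

section Coordinates

variable {k l : ℕ} {μ : Fin k → ℝ} {m : Fin l → ℝ}

/-- The point with coordinates `(x⁺, x⁻, z) = (u, v, z)`. -/
def pt (u v : ℝ) (z : Fin k ⊕ Fin l → ℝ) : PWCoord k l → ℝ := Sum.elim ![u, v] z

@[simp] lemma pt_zero (u v : ℝ) (z : Fin k ⊕ Fin l → ℝ) : pt u v z (Sum.inl 0) = u := rfl

@[simp] lemma pt_one (u v : ℝ) (z : Fin k ⊕ Fin l → ℝ) : pt u v z (Sum.inl 1) = v := rfl

@[simp] lemma pt_inr (u v : ℝ) (z : Fin k ⊕ Fin l → ℝ) (s : Fin k ⊕ Fin l) :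
    pt u v z (Sum.inr s) = z s := rfl

lemma ext_coords {p q : PWCoord k l → ℝ} (h0 : p (Sum.inl 0) = q (Sum.inl 0))
    (h1 : p (Sum.inl 1) = q (Sum.inl 1)) (h : ∀ s, p (Sum.inr s) = q (Sum.inr s)) : p = q := by
  funext i
  rcases i with i | s
  · fin_cases i
    · exact h0
    · exact h1
  · exact h s

lemma forall_coord {C : PWCoord k l → Prop} :
    (∀ i, C i) ↔ C (Sum.inl 0) ∧ C (Sum.inl 1) ∧ ∀ s, C (Sum.inr s) := by
  constructor
  · intro h; exact ⟨h _, h _, fun s => h _⟩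
  · rintro ⟨h0, h1, h⟩ (i | s)
    · fin_cases i
      · exact h0
      · exact h1
    · exact h s

/-- The signed squared frequencies of the transverse modes. -/
def freq (μ : Fin k → ℝ) (m : Fin l → ℝ) : Fin k ⊕ Fin l → ℝ :=
  Sum.elim (fun i => μ i ^ 2) (fun a => -m a ^ 2)

lemma pwPotential_eq (p : PWCoord k l → ℝ) :
    pwPotential μ m p = ∑ s, freq μ m s * p (Sum.inr s) ^ 2 := by
  simp [pwPotential, freq, Fintype.sum_sum_type, sub_eq_add_neg]

lemma pair_planeWave (p v w : PWCoord k l → ℝ) :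
    (planeWave μ m).pair p v w =
      -pwPotential μ m p * v (Sum.inl 0) * w (Sum.inl 0) - v (Sum.inl 0) * w (Sum.inl 1)
        - v (Sum.inl 1) * w (Sum.inl 0) + ∑ s, v (Sum.inr s) * w (Sum.inr s) := by
  simp only [MetricField.pair, planeWave]
  rw [Fintype.sum_sum_type]
  simp only [Fintype.sum_sum_type (α₁ := Fin 2), Matrix.fromBlocks_apply₁₁,
    Matrix.fromBlocks_apply₁₂, Matrix.fromBlocks_apply₂₁, Matrix.fromBlocks_apply₂₂,
    Fin.sum_univ_two, Matrix.zero_apply, zero_mul, Finset.sum_const_zero, Matrix.one_apply]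
  simp
  ring

lemma pair_minkowski (p v w : PWCoord k l → ℝ) :
    (minkowski k l).pair p v w = - v (Sum.inl 0) * w (Sum.inl 1)
        - v (Sum.inl 1) * w (Sum.inl 0) + ∑ s, v (Sum.inr s) * w (Sum.inr s) := by
  simp only [MetricField.pair, minkowski]
  rw [Fintype.sum_sum_type]
  simp only [Fintype.sum_sum_type (α₁ := Fin 2), Matrix.fromBlocks_apply₁₁,
    Matrix.fromBlocks_apply₁₂, Matrix.fromBlocks_apply₂₁, Matrix.fromBlocks_apply₂₂,
    Fin.sum_univ_two, Matrix.zero_apply, zero_mul, Finset.sum_const_zero, Matrix.one_apply]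
  simp
  ring

lemma futureTimelike_iff {p w : PWCoord k l → ℝ} :
    (planeWave μ m).FutureTimelike (fun _ => Pi.single (Sum.inl 1) 1) p w ↔
      0 < w (Sum.inl 0) ∧ ∑ s, w (Sum.inr s) ^ 2
        - (∑ s, freq μ m s * p (Sum.inr s) ^ 2) * w (Sum.inl 0) ^ 2
          < 2 * w (Sum.inl 0) * w (Sum.inl 1) := by
  rw [MetricField.FutureTimelike, pair_planeWave, pair_planeWave, pwPotential_eq, and_comm]
  have h (s : Fin k ⊕ Fin l) : (Pi.single (Sum.inl 1) 1 : PWCoord k l → ℝ) (Sum.inr s) = 0 := by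
    simp
  have h0 : (Pi.single (Sum.inl 1) 1 : PWCoord k l → ℝ) (Sum.inl 0) = 0 := by
    simp
  simp only [h, h0, Pi.single_eq_same]
  refine and_congr ?_ ?_
  · simp
  · simp only [← pow_two]
    constructor <;> intro h <;> nlinarith

end Coordinates

/-! ### Timelike curves and functions increasing along them -/

section Curves

variable {k l : ℕ} {μ : Fin k → ℝ} {m : Fin l → ℝ}

/-- The relation "there is a future-directed timelike `C¹` curve from `p` to `q`". -/
abbrev CurveRel (μ : Fin k → ℝ) (m : Fin l → ℝ) : (PWCoord k l → ℝ) → (PWCoord k l → ℝ) → Prop :=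
  (planeWave μ m).TimelikeCurve (fun _ => Pi.single (Sum.inl 1) 1)

lemma lt_of_hasDerivWithinAt_pos {f f' : ℝ → ℝ} {a b : ℝ} (hab : a < b)
    (hf : ∀ t ∈ Icc a b, HasDerivWithinAt f (f' t) (Icc a b) t)
    (hf' : ∀ t ∈ Icc a b, 0 < f' t) : f a < f b := by
  have : StrictMonoOn f (Icc a b) := by
    refine strictMonoOn_of_deriv_pos (convex_Icc a b)
      (fun t ht => (hf t ht).continuousWithinAt) fun t ht => ?_
    rw [interior_Icc] at ht
    have h := (hf t (Ioo_subset_Icc_self ht)).hasDerivAt (Icc_mem_nhds ht.1 ht.2)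
    rw [h.deriv]
    exact hf' t (Ioo_subset_Icc_self ht)
  exact this (left_mem_Icc.2 hab.le) (right_mem_Icc.2 hab.le) hab

/-- A `C¹` curve parametrised by `x⁺` satisfying the timelike inequality. -/
lemma curveRel_of_graph {a b : ℝ} (hab : a < b) {v v' : ℝ → ℝ}
    {z z' : ℝ → Fin k ⊕ Fin l → ℝ}
    (hv : ∀ u, HasDerivAt v (v' u) u) (hz : ∀ s u, HasDerivAt (fun u => z u s) (z' u s) u)
    (hv' : Continuous v') (hz' : ∀ s, Continuous fun u => z' u s)
    (h : ∀ u ∈ Icc a b, ∑ s, (z' u s ^ 2 - freq μ m s * z u s ^ 2) < 2 * v' u) :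
    CurveRel μ m (pt a (v a) (z a)) (pt b (v b) (z b)) := by
  have hlin (t : ℝ) : HasDerivAt (fun t : ℝ => a + t * (b - a)) (b - a) t := by
    simpa using ((hasDerivAt_id t).mul_const (b - a)).const_add a
  refine ⟨fun t => pt (a + t * (b - a)) (v (a + t * (b - a))) (z (a + t * (b - a))),
    fun t => pt (b - a) (v' (a + t * (b - a)) * (b - a))
      (fun s => z' (a + t * (b - a)) s * (b - a)), by simp, by simp, ?_, ?_⟩
  · refine Continuous.continuousOn (continuous_pi ?_)
    rw [forall_coord]
    refine ⟨?_, ?_, fun s => ?_⟩ <;> simp only [pt_zero, pt_one, pt_inr]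
    · fun_prop
    · fun_prop
    · have := hz' s
      fun_prop
  · intro t ht
    constructor
    · refine HasDerivAt.hasDerivWithinAt (hasDerivAt_pi.2 ?_)
      rw [forall_coord]
      refine ⟨hlin t, ?_, fun s => ?_⟩
      · exact (hv _).comp t (hlin t)
      · exact (hz s _).comp t (hlin t)
    · rw [futureTimelike_iff]
      simp only [pt_zero, pt_one, pt_inr]
      refine ⟨by linarith, ?_⟩
      have hu : a + t * (b - a) ∈ Icc a b := by
        constructor <;> nlinarith [ht.1, ht.2]
      have := h _ hu
      set u := a + t * (b - a)
      rw [Finset.sum_sub_distrib] at this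
      have e : ∑ s, (z' u s * (b - a)) ^ 2 = (∑ s, z' u s ^ 2) * (b - a) ^ 2 := by
        rw [Finset.sum_mul]; exact Finset.sum_congr rfl fun s _ => by ring
      rw [e]
      have hb : 0 < (b - a) ^ 2 := by have := sub_pos.2 hab; positivity
      nlinarith

/-- Functions increasing along every timelike curve inside a set `D`. -/
lemma CurveRel.lt {p q : PWCoord k l → ℝ} (h : CurveRel μ m p q) {Φ : (PWCoord k l → ℝ) → ℝ}
    (hΦ : ∀ (γ : ℝ → PWCoord k l → ℝ) (w : PWCoord k l → ℝ) (t : ℝ),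
      γ t (Sum.inl 0) ∈ Icc (p (Sum.inl 0)) (q (Sum.inl 0)) →
      (∀ i, HasDerivWithinAt (fun t => γ t i) (w i) (Icc 0 1) t) →
      0 < w (Sum.inl 0) →
      ∑ s, w (Sum.inr s) ^ 2 - (∑ s, freq μ m s * γ t (Sum.inr s) ^ 2) * w (Sum.inl 0) ^ 2
          < 2 * w (Sum.inl 0) * w (Sum.inl 1) →
      ∃ d > 0, HasDerivWithinAt (fun t => Φ (γ t)) d (Icc 0 1) t) : Φ p < Φ q := by
  obtain ⟨γ, γ', rfl, rfl, -, hγ⟩ := h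
  have hder (t : ℝ) (ht : t ∈ Icc (0 : ℝ) 1) (i) :
      HasDerivWithinAt (fun t => γ t i) (γ' t i) (Icc 0 1) t :=
    hasDerivWithinAt_pi.1 (hγ t ht).1 i
  have htl (t : ℝ) (ht : t ∈ Icc (0 : ℝ) 1) := futureTimelike_iff.1 (hγ t ht).2
  have hmono : StrictMonoOn (fun t => γ t (Sum.inl 0)) (Icc 0 1) := by
    intro a ha b hb hab
    have hsub : Icc a b ⊆ Icc 0 1 := Icc_subset_Icc ha.1 hb.2
    exact lt_of_hasDerivWithinAt_pos (f := fun t => γ t (Sum.inl 0)) hab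
      (fun t ht => (hder t (hsub ht) _).mono hsub) (fun t ht => (htl t (hsub ht)).1)
  have key (t : ℝ) (ht : t ∈ Icc (0 : ℝ) 1) :=
    hΦ γ (γ' t) t ⟨hmono.monotoneOn (left_mem_Icc.2 zero_le_one) ht ht.1,
      hmono.monotoneOn ht (right_mem_Icc.2 zero_le_one) ht.2⟩ (hder t ht) (htl t ht).1 (htl t ht).2
  choose! d hd0 hd using key
  exact lt_of_hasDerivWithinAt_pos (f := fun t => Φ (γ t)) zero_lt_one hd hd0

lemma CurveRel.xplus_lt {p q : PWCoord k l → ℝ} (h : CurveRel μ m p q) :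
    p (Sum.inl 0) < q (Sum.inl 0) :=
  h.lt (Φ := fun p => p (Sum.inl 0)) fun _ w _ _ hw h0 _ => ⟨w (Sum.inl 0), h0, hw _⟩

lemma chron_of_curveRel {p q : PWCoord k l → ℝ} (h : CurveRel μ m p q) :
    planeWaveChron μ m p q := Relation.TransGen.single h

lemma chron_trans {p q r : PWCoord k l → ℝ} (h : planeWaveChron μ m p q)
    (h' : planeWaveChron μ m q r) : planeWaveChron μ m p r := Relation.TransGen.trans h h'

lemma chron_xplus_lt {p q : PWCoord k l → ℝ} (h : planeWaveChron μ m p q) :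
    p (Sum.inl 0) < q (Sum.inl 0) := by
  induction h with
  | single h => exact CurveRel.xplus_lt h
  | tail _ h ih => exact ih.trans (CurveRel.xplus_lt h)

lemma chron_lt {p q : PWCoord k l → ℝ} (h : planeWaveChron μ m p q) {a b : ℝ}
    {Φ : (PWCoord k l → ℝ) → ℝ} (ha : a ≤ p (Sum.inl 0)) (hb : q (Sum.inl 0) ≤ b)
    (hΦ : ∀ (γ : ℝ → PWCoord k l → ℝ) (w : PWCoord k l → ℝ) (t : ℝ),
      γ t (Sum.inl 0) ∈ Icc a b →
      (∀ i, HasDerivWithinAt (fun t => γ t i) (w i) (Icc 0 1) t) →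
      0 < w (Sum.inl 0) →
      ∑ s, w (Sum.inr s) ^ 2 - (∑ s, freq μ m s * γ t (Sum.inr s) ^ 2) * w (Sum.inl 0) ^ 2
          < 2 * w (Sum.inl 0) * w (Sum.inl 1) →
      ∃ d > 0, HasDerivWithinAt (fun t => Φ (γ t)) d (Icc 0 1) t) : Φ p < Φ q := by
  induction h with
  | single h =>
    exact CurveRel.lt h fun γ w t ht => hΦ γ w t ⟨ha.trans ht.1, ht.2.trans hb⟩
  | tail h h' ih =>
    have hu := chron_xplus_lt h
    have hu' := CurveRel.xplus_lt h'
    refine (ih (hu'.le.trans hb)).trans (CurveRel.lt h' fun γ w t ht => hΦ γ w t ?_)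
    exact ⟨(ha.trans hu.le).trans ht.1, ht.2.trans hb⟩

/-! ### Symmetries -/

/-- The isometry `(u, v, z) ↦ (-u, -v, z)`, which reverses the time orientation. -/
def timeReversal (p : PWCoord k l → ℝ) : PWCoord k l → ℝ :=
  pt (-p (Sum.inl 0)) (-p (Sum.inl 1)) (fun s => p (Sum.inr s))

@[simp] lemma timeReversal_timeReversal (p : PWCoord k l → ℝ) :
    timeReversal (timeReversal p) = p := by
  refine ext_coords ?_ ?_ fun s => ?_ <;> simp [timeReversal]

lemma curveRel_timeReversal {p q : PWCoord k l → ℝ} (h : CurveRel μ m p q) :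
    CurveRel μ m (timeReversal q) (timeReversal p) := by
  obtain ⟨γ, γ', rfl, rfl, hc, hγ⟩ := h
  have hmaps : MapsTo (fun t : ℝ => 1 - t) (Icc 0 1) (Icc 0 1) := fun t ht =>
    ⟨by linarith [ht.2], by linarith [ht.1]⟩
  have hlin (t : ℝ) : HasDerivWithinAt (fun t : ℝ => 1 - t) (-1) (Icc 0 1) t := by
    simpa using ((hasDerivAt_id t).const_sub 1).hasDerivWithinAt
  refine ⟨fun t => timeReversal (γ (1 - t)), fun t => pt (γ' (1 - t) (Sum.inl 0))
    (γ' (1 - t) (Sum.inl 1)) (fun s => -γ' (1 - t) (Sum.inr s)), by simp, by simp, ?_, ?_⟩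
  · have hc' : ContinuousOn (fun t => γ' (1 - t)) (Icc 0 1) :=
      hc.comp (by fun_prop) hmaps
    rw [continuousOn_pi] at hc' ⊢
    rw [forall_coord]
    exact ⟨hc' _, hc' _, fun s => (hc' _).neg⟩
  · intro t ht
    obtain ⟨h1, h2⟩ := hγ (1 - t) (hmaps ht)
    rw [hasDerivWithinAt_pi] at h1 ⊢
    have h3 (i) := (h1 i).comp t (hlin t) hmaps
    constructor
    · rw [forall_coord]
      refine ⟨?_, ?_, fun s => ?_⟩
      · exact (h3 (Sum.inl 0)).neg.congr_deriv (by simp)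
      · exact (h3 (Sum.inl 1)).neg.congr_deriv (by simp)
      · exact (h3 (Sum.inr s)).congr_deriv (by simp)
    · rw [futureTimelike_iff] at h2 ⊢
      simpa [timeReversal] using h2

lemma chron_timeReversal {p q : PWCoord k l → ℝ} (h : planeWaveChron μ m p q) :
    planeWaveChron μ m (timeReversal q) (timeReversal p) := by
  induction h with
  | single h => exact chron_of_curveRel (curveRel_timeReversal h)
  | tail _ h ih => exact chron_trans (chron_of_curveRel (curveRel_timeReversal h)) ih

lemma chron_timeReversal_iff {p q : PWCoord k l → ℝ} :
    planeWaveChron μ m (timeReversal q) (timeReversal p) ↔ planeWaveChron μ m p q :=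
  ⟨fun h => by simpa using chron_timeReversal h, chron_timeReversal⟩

lemma curveRel_translate {p q : PWCoord k l → ℝ} (h : CurveRel μ m p q) (a b : ℝ) :
    CurveRel μ m (p + pt a b 0) (q + pt a b 0) := by
  obtain ⟨γ, γ', rfl, rfl, hc, hγ⟩ := h
  refine ⟨fun t => γ t + pt a b 0, γ', rfl, rfl, hc, fun t ht =>
    ⟨(hγ t ht).1.add_const _, ?_⟩⟩
  have := (hγ t ht).2
  rw [futureTimelike_iff] at this ⊢
  simpa using this

lemma chron_translate {p q : PWCoord k l → ℝ} (h : planeWaveChron μ m p q) (a b : ℝ) :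
    planeWaveChron μ m (p + pt a b 0) (q + pt a b 0) := by
  induction h with
  | single h => exact chron_of_curveRel (curveRel_translate h a b)
  | tail _ h ih => exact chron_trans ih (chron_of_curveRel (curveRel_translate h a b))

/-! ### Openness -/

/-- Being timelike is an open condition and the parameter interval is compact, so a small affine
correction that fixes the starting point can move the endpoint in any direction. -/
lemma curveRel_eventually {p q : PWCoord k l → ℝ} (h : CurveRel μ m p q) :
    ∀ᶠ r in 𝓝 q, CurveRel μ m p r := by
  obtain ⟨γ, γ', rfl, rfl, hc, hγ⟩ := h
  have hγc : ContinuousOn γ (Icc 0 1) := fun t ht => (hγ t ht).1.continuousWithinAt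
  -- Clamping the parameter gives globally continuous extensions, as the compactness argument needs
  -- full neighbourhoods of each `t`.
  set G : ℝ → PWCoord k l → ℝ := fun t => γ (projIcc (0 : ℝ) 1 zero_le_one t) with hG
  set G' : ℝ → PWCoord k l → ℝ := fun t => γ' (projIcc (0 : ℝ) 1 zero_le_one t) with hG'
  have hGc : Continuous G := hγc.domRestrict.Icc_extend'
  have hGc' : Continuous G' := hc.domRestrict.Icc_extend'
  have hGe (t : ℝ) (ht : t ∈ Icc (0 : ℝ) 1) : G t = γ t := by simp [hG, projIcc_of_mem _ ht]
  have hGe' (t : ℝ) (ht : t ∈ Icc (0 : ℝ) 1) : G' t = γ' t := by simp [hG', projIcc_of_mem _ ht]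
  have hcoord (i) : Continuous fun x : (PWCoord k l → ℝ) × ℝ => G x.2 i :=
    (continuous_apply i).comp (hGc.comp continuous_snd)
  have hcoord' (i) : Continuous fun x : (PWCoord k l → ℝ) × ℝ => G' x.2 i :=
    (continuous_apply i).comp (hGc'.comp continuous_snd)
  have key : ∀ᶠ w in 𝓝 (0 : PWCoord k l → ℝ), ∀ t ∈ Icc (0 : ℝ) 1,
      0 < G' t (Sum.inl 0) + w (Sum.inl 0) ∧
      ∑ s, (G' t (Sum.inr s) + w (Sum.inr s)) ^ 2
        - (∑ s, freq μ m s * (G t (Sum.inr s) + t * w (Sum.inr s)) ^ 2)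
          * (G' t (Sum.inl 0) + w (Sum.inl 0)) ^ 2
      < 2 * (G' t (Sum.inl 0) + w (Sum.inl 0)) * (G' t (Sum.inl 1) + w (Sum.inl 1)) := by
    refine isCompact_Icc.eventually_forall_of_forall_eventually fun t ht => ?_
    have h2 := (hγ t ht).2
    rw [futureTimelike_iff, ← hGe t ht, ← hGe' t ht] at h2
    refine (ContinuousAt.eventually_lt (f := fun _ : (PWCoord k l → ℝ) × ℝ => (0 : ℝ))
      (g := fun x : (PWCoord k l → ℝ) × ℝ => G' x.2 (Sum.inl 0) + x.1 (Sum.inl 0))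
      continuousAt_const ?_ ?_).and (ContinuousAt.eventually_lt ?_ ?_ ?_)
    · exact ((hcoord' _).add (by fun_prop)).continuousAt
    · simpa using h2.1
    · refine Continuous.continuousAt ?_
      refine Continuous.sub ?_ (Continuous.mul ?_ ?_)
      · exact continuous_finsetSum _ fun s _ => ((hcoord' _).add (by fun_prop)).pow 2
      · exact continuous_finsetSum _ fun s _ =>
          continuous_const.mul (((hcoord _).add (by fun_prop)).pow 2)
      · exact ((hcoord' _).add (by fun_prop)).pow 2
    · exact ((continuous_const.mul ((hcoord' _).add (by fun_prop))).mul
        ((hcoord' _).add (by fun_prop))).continuousAt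
    · simpa using h2.2
  have hsub : Tendsto (fun r => r - γ 1) (𝓝 (γ 1)) (𝓝 0) := by
    have : Continuous fun r : PWCoord k l → ℝ => r - γ 1 := by fun_prop
    simpa using this.tendsto (γ 1)
  filter_upwards [hsub.eventually key] with r hr
  refine ⟨fun t => γ t + t • (r - γ 1), fun t => γ' t + (r - γ 1), by simp, by simp,
    hc.add continuousOn_const, fun t ht => ⟨?_, ?_⟩⟩
  · refine (hγ t ht).1.add ?_
    simpa using ((hasDerivAt_id t).smul_const (r - γ 1)).hasDerivWithinAt
  · have := hr t ht
    rw [hGe t ht, hGe' t ht] at this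
    rw [futureTimelike_iff]
    simpa using this

lemma chron_eventually_right {p q : PWCoord k l → ℝ} (h : planeWaveChron μ m p q) :
    ∀ᶠ r in 𝓝 q, planeWaveChron μ m p r := by
  cases h with
  | single h => exact (curveRel_eventually h).mono fun r hr => chron_of_curveRel hr
  | tail h' h =>
    exact (curveRel_eventually h).mono fun r hr => chron_trans h' (chron_of_curveRel hr)

end Curves

end PlaneWave

/-! ## Solutions of `y'' = -λ y` -/

namespace PlaneWave

section Trig

open Real

/-- The solution of `y'' = -lam y` with `y 0 = 0`, `y' 0 = 1`. -/
noncomputable def gsin (lam u : ℝ) : ℝ :=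
  if 0 < lam then sin (√lam * u) / √lam else
    if lam = 0 then u else sinh (√(-lam) * u) / √(-lam)

/-- The solution of `y'' = -lam y` with `y 0 = 1`, `y' 0 = 0`. -/
noncomputable def gcos (lam u : ℝ) : ℝ :=
  if 0 < lam then cos (√lam * u) else if lam = 0 then 1 else cosh (√(-lam) * u)

/-- The quotient `gsin / gcos`. -/
noncomputable def gtan (lam u : ℝ) : ℝ := gsin lam u / gcos lam u

lemma hasDerivAt_gsin (lam u : ℝ) : HasDerivAt (gsin lam) (gcos lam u) u := by
  rcases lt_trichotomy 0 lam with h | h | h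
  · have hne : √lam ≠ 0 := (sqrt_pos.2 h).ne'
    have e : gsin lam = fun u => sin (√lam * u) / √lam := by funext u; simp [gsin, h]
    rw [e]
    have := (((hasDerivAt_id u).const_mul √lam).sin).div_const √lam
    refine this.congr_deriv ?_
    simp only [gcos, h, if_true, id]
    field_simp
  · have e : gsin lam = fun u => u := by funext u; simp [gsin, ← h]
    rw [e]
    refine (hasDerivAt_id u).congr_deriv ?_
    simp [gcos, ← h]
  · have hne : √(-lam) ≠ 0 := (sqrt_pos.2 (by linarith)).ne'
    have e : gsin lam = fun u => sinh (√(-lam) * u) / √(-lam) := by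
      funext u; simp [gsin, h.not_gt, h.ne]
    rw [e]
    have := (((hasDerivAt_id u).const_mul √(-lam)).sinh).div_const √(-lam)
    refine this.congr_deriv ?_
    simp only [gcos, h.not_gt, h.ne, if_false, id]
    field_simp

lemma hasDerivAt_gcos (lam u : ℝ) : HasDerivAt (gcos lam) (-lam * gsin lam u) u := by
  rcases lt_trichotomy 0 lam with h | h | h
  · have hne : √lam ≠ 0 := (sqrt_pos.2 h).ne'
    have e : gcos lam = fun u => cos (√lam * u) := by funext u; simp [gcos, h]
    rw [e]
    refine (((hasDerivAt_id u).const_mul √lam).cos).congr_deriv ?_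
    simp only [gsin, h, if_true, id]
    field_simp
    rw [sq_sqrt h.le]
    ring
  · have e : gcos lam = fun u => 1 := by funext u; simp [gcos, ← h]
    rw [e]
    refine (hasDerivAt_const u _).congr_deriv ?_
    simp [← h]
  · have hne : √(-lam) ≠ 0 := (sqrt_pos.2 (by linarith)).ne'
    have e : gcos lam = fun u => cosh (√(-lam) * u) := by
      funext u; simp [gcos, h.not_gt, h.ne]
    rw [e]
    refine (((hasDerivAt_id u).const_mul √(-lam)).cosh).congr_deriv ?_
    simp only [gsin, h.not_gt, h.ne, if_false, id]
    field_simp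
    rw [sq_sqrt (by linarith)]
    ring

@[fun_prop] lemma continuous_gsin (lam : ℝ) : Continuous (gsin lam) :=
  continuous_iff_continuousAt.2 fun u => (hasDerivAt_gsin lam u).continuousAt

@[fun_prop] lemma continuous_gcos (lam : ℝ) : Continuous (gcos lam) :=
  continuous_iff_continuousAt.2 fun u => (hasDerivAt_gcos lam u).continuousAt

@[simp] lemma gsin_zero (lam : ℝ) : gsin lam 0 = 0 := by simp [gsin]

@[simp] lemma gcos_zero (lam : ℝ) : gcos lam 0 = 1 := by simp [gcos]

@[simp] lemma gtan_zero (lam : ℝ) : gtan lam 0 = 0 := by simp [gtan]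

lemma gcos_sq_add (lam u : ℝ) : gcos lam u ^ 2 + lam * gsin lam u ^ 2 = 1 := by
  rcases lt_trichotomy 0 lam with h | h | h
  · simp only [gsin, gcos, h, if_true, div_pow, sq_sqrt h.le]
    rw [mul_div_cancel₀ _ h.ne', cos_sq_add_sin_sq]
  · simp [gcos, ← h]
  · simp only [gsin, gcos, h.not_gt, h.ne, if_false, div_pow, sq_sqrt (neg_pos.2 h).le]
    rw [cosh_sq]
    have := h.ne
    field_simp
    ring

/-- A mode of smaller frequency reaches its first zero later, or never if `lam ≤ 0`. So one interval
serves all modes at once. -/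
lemma gcos_pos {lam ν u : ℝ} (hν : 0 < ν) (hlam : lam ≤ ν ^ 2) (hu : |u| < π / (2 * ν)) :
    0 < gcos lam u := by
  rcases lt_trichotomy 0 lam with h | h | h
  · simp only [gcos, h, if_true]
    have h1 : √lam ≤ ν := by rw [sqrt_le_left hν.le]; exact hlam
    have h2 : |√lam * u| < π / 2 := by
      rw [abs_mul, abs_of_nonneg (sqrt_nonneg _)]
      calc √lam * |u| ≤ ν * |u| := by gcongr
        _ < ν * (π / (2 * ν)) := by gcongr
        _ = π / 2 := by field_simp
    rw [abs_lt] at h2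
    exact cos_pos_of_mem_Ioo h2
  · simp [gcos, ← h]
  · simp only [gcos, h.not_gt, h.ne, if_false]
    exact cosh_pos _

/-- The strict gap between the frequencies becomes a strict gap in focusing time. The lower bound on
`w` gives the final contradiction; the upper bound keeps `[0, w]` inside the Rosen range of the
other modes. -/
lemma exists_gcos_pos {lam ν : ℝ} (hν : 0 < ν) (hlam : lam < ν ^ 2) :
    ∃ w, π / (2 * ν) < w ∧ w < π / ν ∧ ∀ u ∈ Icc 0 w, 0 < gcos lam u := by
  -- For `lam ≤ 0` the root is `0`, and `ν / 2` keeps `ν'` positive. It also ensures `π / (2 * ν') ≤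
  -- π / ν`.
  set ν' := max √lam (ν / 2) with hν'
  have h1 : ν' < ν := by
    refine max_lt ?_ (by linarith)
    rwa [sqrt_lt' hν]
  have h2 : ν / 2 ≤ ν' := le_max_right _ _
  have h0 : 0 < ν' := by linarith
  have h3 : lam ≤ ν' ^ 2 := by
    rw [← sqrt_le_left h0.le]; exact le_max_left _ _
  have h4 : π / (2 * ν) < π / (2 * ν') := by gcongr
  have h5 : π / (2 * ν') ≤ π / ν := by
    apply div_le_div_of_nonneg_left pi_pos.le hν; linarith
  refine ⟨(π / (2 * ν) + π / (2 * ν')) / 2, by linarith, by linarith, fun u hu => ?_⟩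
  refine gcos_pos h0 h3 ?_
  rw [abs_of_nonneg hu.1]
  linarith [hu.2]

lemma hasDerivAt_gtan {lam u : ℝ} (h : gcos lam u ≠ 0) :
    HasDerivAt (gtan lam) (1 / gcos lam u ^ 2) u := by
  refine ((hasDerivAt_gsin lam u).div (hasDerivAt_gcos lam u) h).congr_deriv ?_
  rw [← gcos_sq_add lam u]
  ring

lemma gtan_lt_gtan {lam a b c : ℝ} (hab : a < b) (h : ∀ u ∈ Icc a b, 0 < gcos lam (u - c)) :
    gtan lam (a - c) < gtan lam (b - c) := by
  refine lt_of_hasDerivWithinAt_pos (f := fun u => gtan lam (u - c))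
    (f' := fun u => 1 / gcos lam (u - c) ^ 2) hab (fun t ht => ?_) (fun t ht => ?_)
  · have := (hasDerivAt_gtan (h t ht).ne').comp_sub_const t c
    exact this.hasDerivWithinAt
  · have := h t ht
    positivity

end Trig

end PlaneWave

/-! ## Rosen coordinates and the chronology relation -/

namespace PlaneWave

variable {k l : ℕ} {μ : Fin k → ℝ} {m : Fin l → ℝ}

/-- The Rosen coordinate `V`, where the mode `s` is centred at `x⁺ = c s`. -/
noncomputable def rosenV (lam c : Fin k ⊕ Fin l → ℝ) (p : PWCoord k l → ℝ) : ℝ :=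
  p (Sum.inl 1) + 1 / 2 * ∑ s, lam s * gtan (lam s) (p (Sum.inl 0) - c s) * p (Sum.inr s) ^ 2

/-- The transverse Rosen coordinates. -/
noncomputable def rosenZ (lam c : Fin k ⊕ Fin l → ℝ) (p : PWCoord k l → ℝ)
    (s : Fin k ⊕ Fin l) : ℝ :=
  p (Sum.inr s) / gcos (lam s) (p (Sum.inl 0) - c s)

/-- The time parameter of the mode `s` in Rosen coordinates. -/
noncomputable def rosenT (lam c : Fin k ⊕ Fin l → ℝ) (p : PWCoord k l → ℝ)
    (s : Fin k ⊕ Fin l) : ℝ :=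
  gtan (lam s) (p (Sum.inl 0) - c s)

/-- In Rosen coordinates the metric is `-2 dx⁺ dV + ∑ C_s² dZ_s²` with `dT_s = dx⁺ / C_s²`, so
timelike curves satisfy `2 dV > ∑ dZ_s² / dT_s`. Replacing each quotient by its tangent line `2 κ dZ
- κ² dT` makes the bound integrable along any curve. -/
lemma chron_rosen_lt {p q : PWCoord k l → ℝ} (h : planeWaveChron μ m p q) {a b : ℝ}
    {c : Fin k ⊕ Fin l → ℝ} (ha : a ≤ p (Sum.inl 0)) (hb : q (Sum.inl 0) ≤ b)
    (hc : ∀ s, ∀ u ∈ Icc a b, 0 < gcos (freq μ m s) (u - c s)) (κ : Fin k ⊕ Fin l → ℝ) :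
    ∑ s, (2 * κ s * (rosenZ (freq μ m) c q s - rosenZ (freq μ m) c p s)
      - κ s ^ 2 * (rosenT (freq μ m) c q s - rosenT (freq μ m) c p s))
      < 2 * (rosenV (freq μ m) c q - rosenV (freq μ m) c p) := by
  set lam := freq μ m with hlam
  have key := chron_lt h (a := a) (b := b) (Φ := fun p => 2 * p (Sum.inl 1) + ∑ s,
    (lam s * (gtan (lam s) (p (Sum.inl 0) - c s) * p (Sum.inr s) ^ 2)
      - 2 * κ s * (p (Sum.inr s) / gcos (lam s) (p (Sum.inl 0) - c s))
      + κ s ^ 2 * gtan (lam s) (p (Sum.inl 0) - c s))) ha hb ?_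
  · simp only [Finset.sum_add_distrib, Finset.sum_sub_distrib] at key
    simp only [rosenV, rosenZ, rosenT, mul_sub, Finset.sum_sub_distrib, mul_add, ← mul_assoc]
    simp only [← mul_assoc] at key
    linarith
  · intro γ w t ht hγ hw0 hw
    set u := γ t (Sum.inl 0) with hu
    have hC (s) : 0 < gcos (lam s) (u - c s) := hc s u ht
    have hsub (s) : HasDerivWithinAt (fun t => γ t (Sum.inl 0) - c s) (w (Sum.inl 0))
        (Icc 0 1) t := (hγ _).sub_const _
    have hT (s) : HasDerivWithinAt (fun t => gtan (lam s) (γ t (Sum.inl 0) - c s))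
        (1 / gcos (lam s) (u - c s) ^ 2 * w (Sum.inl 0)) (Icc 0 1) t :=
      HasDerivAt.comp_hasDerivWithinAt (h₂ := gtan (lam s)) t (hasDerivAt_gtan (hC s).ne') (hsub s)
    have hD (s) : HasDerivWithinAt (fun t => gcos (lam s) (γ t (Sum.inl 0) - c s))
        (-lam s * gsin (lam s) (u - c s) * w (Sum.inl 0)) (Icc 0 1) t :=
      HasDerivAt.comp_hasDerivWithinAt (h₂ := gcos (lam s)) t (hasDerivAt_gcos _ _) (hsub s)
    have hder := ((hγ (Sum.inl 1)).const_mul 2).add (HasDerivWithinAt.fun_sum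
      (u := Finset.univ) fun s _ =>
      ((((hT s).mul ((hγ (Sum.inr s)).pow 2)).const_mul (lam s)).sub
        (((hγ (Sum.inr s)).div (hD s) (hC s).ne').const_mul (2 * κ s))).add
        ((hT s).const_mul (κ s ^ 2)))
    refine ⟨_, ?_, hder⟩
    -- Completing the square: multiplied by the `x⁺`-velocity, the contribution of mode `s` is a
    -- square minus the term that the timelike inequality controls.
    have hid (s) : w (Sum.inl 0) * (lam s * (1 / gcos (lam s) (u - c s) ^ 2 * w (Sum.inl 0)
        * γ t (Sum.inr s) ^ 2 + gtan (lam s) (u - c s) * (2 * γ t (Sum.inr s) * w (Sum.inr s)))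
        - 2 * κ s * ((w (Sum.inr s) * gcos (lam s) (u - c s) - γ t (Sum.inr s) *
          (-lam s * gsin (lam s) (u - c s) * w (Sum.inl 0))) / gcos (lam s) (u - c s) ^ 2)
        + κ s ^ 2 * (1 / gcos (lam s) (u - c s) ^ 2 * w (Sum.inl 0)))
        = (w (Sum.inr s) + lam s * gtan (lam s) (u - c s) * γ t (Sum.inr s) * w (Sum.inl 0)
          - κ s * w (Sum.inl 0) / gcos (lam s) (u - c s)) ^ 2
          - (w (Sum.inr s) ^ 2 - lam s * γ t (Sum.inr s) ^ 2 * w (Sum.inl 0) ^ 2) := by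
      have h1 := gcos_sq_add (lam s) (u - c s)
      have h2 := (hC s).ne'
      simp only [gtan]
      field_simp
      linear_combination (-lam s * w (Sum.inl 0) ^ 2 * γ t (Sum.inr s) ^ 2) * h1
    rw [Finset.sum_mul, ← Finset.sum_sub_distrib] at hw
    have hsq : 0 ≤ ∑ s, (w (Sum.inr s) + lam s * gtan (lam s) (u - c s) * γ t (Sum.inr s)
        * w (Sum.inl 0) - κ s * w (Sum.inl 0) / gcos (lam s) (u - c s)) ^ 2 :=
      Finset.sum_nonneg fun s _ => sq_nonneg _
    refine pos_of_mul_pos_right (a := w (Sum.inl 0)) ?_ hw0.le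
    rw [mul_add, Finset.mul_sum]
    simp only [Pi.pow_apply, Nat.cast_ofNat, Nat.add_one_sub_one, pow_one, ← hu]
    rw [Finset.sum_congr rfl fun s _ => hid s, Finset.sum_sub_distrib]
    linarith

/-- The sum of `(Δ Z_s)² / Δ T_s`. -/
noncomputable def rosenQ (lam c : Fin k ⊕ Fin l → ℝ) (p q : PWCoord k l → ℝ) : ℝ :=
  ∑ s, (rosenZ lam c q s - rosenZ lam c p s) ^ 2 / (rosenT lam c q s - rosenT lam c p s)

lemma rosenT_lt {lam c : Fin k ⊕ Fin l → ℝ} {p q : PWCoord k l → ℝ}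
    (h : p (Sum.inl 0) < q (Sum.inl 0)) {s : Fin k ⊕ Fin l}
    (hc : ∀ u ∈ Icc (p (Sum.inl 0)) (q (Sum.inl 0)), 0 < gcos (lam s) (u - c s)) :
    rosenT lam c p s < rosenT lam c q s := gtan_lt_gtan h hc

/-- In Rosen coordinates the chronology relation is given by an explicit inequality. -/
lemma rosenQ_lt_of_chron {p q : PWCoord k l → ℝ} (h : planeWaveChron μ m p q)
    {c : Fin k ⊕ Fin l → ℝ}
    (hc : ∀ s, ∀ u ∈ Icc (p (Sum.inl 0)) (q (Sum.inl 0)), 0 < gcos (freq μ m s) (u - c s)) :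
    rosenQ (freq μ m) c p q < 2 * (rosenV (freq μ m) c q - rosenV (freq μ m) c p) := by
  -- The slope `ΔZ / ΔT` maximises `2 κ ΔZ - κ² ΔT`, with maximum `(ΔZ)² / ΔT`.
  refine lt_of_eq_of_lt ?_ (chron_rosen_lt h le_rfl le_rfl hc fun s =>
    (rosenZ (freq μ m) c q s - rosenZ (freq μ m) c p s)
      / (rosenT (freq μ m) c q s - rosenT (freq μ m) c p s))
  refine Finset.sum_congr rfl fun s _ => ?_
  have := sub_pos.2 (rosenT_lt (lam := freq μ m) (chron_xplus_lt h) (hc s))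
  field_simp
  ring

/-- The extremal transverse path is affine in Rosen coordinates, `Z = A + κ T`, that is, the
solution of `z'' = -lam z` joining the endpoints. Its action is the boundary term of `z z'`, and the
strict inequality leaves a surplus of `x⁻` to be spent uniformly. -/
lemma chron_of_rosenQ_lt {p q : PWCoord k l → ℝ} (hu : p (Sum.inl 0) < q (Sum.inl 0))
    {c : Fin k ⊕ Fin l → ℝ}
    (hc : ∀ s, ∀ u ∈ Icc (p (Sum.inl 0)) (q (Sum.inl 0)), 0 < gcos (freq μ m s) (u - c s))
    (h : rosenQ (freq μ m) c p q < 2 * (rosenV (freq μ m) c q - rosenV (freq μ m) c p)) :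
    planeWaveChron μ m p q := by
  set lam := freq μ m with hlam
  set a := p (Sum.inl 0) with ha
  set b := q (Sum.inl 0) with hb
  have hCa (s) : gcos (lam s) (a - c s) ≠ 0 := (hc s a (left_mem_Icc.2 hu.le)).ne'
  have hCb (s) : gcos (lam s) (b - c s) ≠ 0 := (hc s b (right_mem_Icc.2 hu.le)).ne'
  have hT (s) : 0 < gtan (lam s) (b - c s) - gtan (lam s) (a - c s) :=
    sub_pos.2 (gtan_lt_gtan hu (hc s))
  set κ : Fin k ⊕ Fin l → ℝ := fun s => (rosenZ lam c q s - rosenZ lam c p s)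
    / (gtan (lam s) (b - c s) - gtan (lam s) (a - c s)) with hκ
  have hκ' (s) : κ s * (gtan (lam s) (b - c s) - gtan (lam s) (a - c s))
      = rosenZ lam c q s - rosenZ lam c p s := div_mul_cancel₀ _ (hT s).ne'
  set A : Fin k ⊕ Fin l → ℝ := fun s => rosenZ lam c p s - κ s * gtan (lam s) (a - c s) with hA
  set z : ℝ → Fin k ⊕ Fin l → ℝ := fun u s =>
    A s * gcos (lam s) (u - c s) + κ s * gsin (lam s) (u - c s) with hz
  set z' : ℝ → Fin k ⊕ Fin l → ℝ := fun u s =>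
    A s * (-lam s * gsin (lam s) (u - c s)) + κ s * gcos (lam s) (u - c s) with hz'
  have hdz (s u) : HasDerivAt (fun u => z u s) (z' u s) u :=
    (((hasDerivAt_gcos (lam s) (u - c s)).comp_sub_const u (c s)).const_mul (A s)).add
      (((hasDerivAt_gsin (lam s) (u - c s)).comp_sub_const u (c s)).const_mul (κ s))
  have hdz' (s u) : HasDerivAt (fun u => z' u s) (-lam s * z u s) u := by
    refine ((((hasDerivAt_gsin (lam s) (u - c s)).comp_sub_const u (c s)).const_mul
      (-lam s)).const_mul (A s)).add (((hasDerivAt_gcos (lam s) (u - c s)).comp_sub_const u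
      (c s)).const_mul (κ s)) |>.congr_deriv ?_
    simp only [hz]
    ring
  -- The surplus: twice the available `Δx⁻` minus the action of the extremal path. Spreading it
  -- evenly makes the null extremal timelike.
  set E : ℝ := 2 * (q (Sum.inl 1) - p (Sum.inl 1))
    - ∑ s, (z b s * z' b s - z a s * z' a s) with hE
  have hza (s) : z a s = p (Sum.inr s) := by
    have h1 := hCa s
    simp only [hz, hA, rosenZ, gtan, ← ha]
    field_simp
    ring
  have hzb (s) : z b s = q (Sum.inr s) := by
    have h1 := hCb s
    have e : z b s = gcos (lam s) (b - c s) * (rosenZ lam c p s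
        + κ s * (gtan (lam s) (b - c s) - gtan (lam s) (a - c s))) := by
      simp only [hz, hA]
      rw [gtan, gtan]
      field_simp
      ring
    rw [e, hκ', add_sub_cancel, rosenZ, ← hb]
    field_simp
  have hzz (u s) (hC : gcos (lam s) (u - c s) ≠ 0) :
      z' u s + lam s * gtan (lam s) (u - c s) * z u s = κ s / gcos (lam s) (u - c s) := by
    have h1 := gcos_sq_add (lam s) (u - c s)
    simp only [hz, hz', gtan]
    field_simp
    linear_combination κ s * h1
  have hEpos : 0 < E := by
    have e : E = 2 * (rosenV lam c q - rosenV lam c p) - rosenQ lam c p q := by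
      have e1 : rosenQ lam c p q = ∑ s, (z b s * z' b s - z a s * z' a s)
          + (∑ s, lam s * gtan (lam s) (b - c s) * q (Sum.inr s) ^ 2
          - ∑ s, lam s * gtan (lam s) (a - c s) * p (Sum.inr s) ^ 2) := by
        rw [← Finset.sum_sub_distrib, ← Finset.sum_add_distrib, rosenQ]
        refine Finset.sum_congr rfl fun s _ => ?_
        have e2 : (rosenZ lam c q s - rosenZ lam c p s) ^ 2
            / (rosenT lam c q s - rosenT lam c p s)
            = κ s * (rosenZ lam c q s - rosenZ lam c p s) := by
          simp only [hκ, rosenT, ← ha, ← hb]; ring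
        have e3 : rosenZ lam c q s * κ s
            = z b s * (z' b s + lam s * gtan (lam s) (b - c s) * z b s) := by
          rw [hzz b s (hCb s), hzb, rosenZ, ← hb]; ring
        have e4 : rosenZ lam c p s * κ s
            = z a s * (z' a s + lam s * gtan (lam s) (a - c s) * z a s) := by
          rw [hzz a s (hCa s), hza, rosenZ, ← ha]; ring
        rw [e2, ← hza s, ← hzb s]
        linear_combination e3 - e4
      rw [e1, rosenV, rosenV]
      ring
    rw [e]; linarith
  have hab := sub_pos.2 hu
  have hcur := curveRel_of_graph (μ := μ) (m := m) (a := a) (b := b) hu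
    (v := fun u => p (Sum.inl 1) + 1 / 2 * ∑ s, (z u s * z' u s - z a s * z' a s)
      + E / (2 * (b - a)) * (u - a))
    (v' := fun u => 1 / 2 * ∑ s, (z' u s * z' u s + z u s * (-lam s * z u s)) + E / (2 * (b - a)))
    (z := z) (z' := z') (fun u => ?_) hdz ?_ (fun s => ?_) (fun u _ => ?_)
  · refine chron_of_curveRel ?_
    have ep : pt a (p (Sum.inl 1) + 1 / 2 * ∑ s, (z a s * z' a s - z a s * z' a s)
        + E / (2 * (b - a)) * (a - a)) (z a) = p :=
      ext_coords rfl (by simp) hza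
    have eq : pt b (p (Sum.inl 1) + 1 / 2 * ∑ s, (z b s * z' b s - z a s * z' a s)
        + E / (2 * (b - a)) * (b - a)) (z b) = q := by
      refine ext_coords rfl ?_ hzb
      have : E / (2 * (b - a)) * (b - a) = E / 2 := by field_simp
      rw [pt_one, this, hE]
      ring
    rwa [ep, eq] at hcur
  · have h1 : HasDerivAt (fun u => ∑ s, (z u s * z' u s - z a s * z' a s))
        (∑ s, (z' u s * z' u s + z u s * (-lam s * z u s))) u :=
      HasDerivAt.fun_sum fun s _ => ((hdz s u).mul (hdz' s u)).sub_const _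
    have h2 := ((h1.const_mul (1 / 2)).const_add (p (Sum.inl 1))).add
      (((hasDerivAt_id u).sub_const a).const_mul (E / (2 * (b - a))))
    exact h2.congr_deriv (by simp)
  · simp only [hz, hz']
    fun_prop
  · simp only [hz']
    fun_prop
  · have : 0 < E / (2 * (b - a)) := by positivity
    have e : ∑ s, (z' u s * z' u s + z u s * (-lam s * z u s))
        = ∑ s, (z' u s ^ 2 - lam s * z u s ^ 2) := Finset.sum_congr rfl fun s _ => by ring
    rw [e]
    linarith

end PlaneWave

/-! ## Short and long range behaviour of the chronology relation -/

namespace PlaneWave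

variable {k l : ℕ} {μ : Fin k → ℝ} {m : Fin l → ℝ}

lemma chron_add_pt (p : PWCoord k l → ℝ) {K ε : ℝ}
    (hK : -(∑ s, freq μ m s * p (Sum.inr s) ^ 2) < 2 * K) (hε : 0 < ε) :
    planeWaveChron μ m p (p + pt ε (K * ε) 0) := by
  have h := curveRel_of_graph (μ := μ) (m := m) (a := p (Sum.inl 0))
    (b := p (Sum.inl 0) + ε) (by linarith)
    (v := fun u => p (Sum.inl 1) + K * (u - p (Sum.inl 0))) (v' := fun _ => K)
    (z := fun _ s => p (Sum.inr s)) (z' := fun _ _ => 0)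
    (fun u => by
      simpa using (((hasDerivAt_id u).sub_const (p (Sum.inl 0))).const_mul K).const_add
        (p (Sum.inl 1)))
    (fun s u => hasDerivAt_const u _) continuous_const (fun _ => continuous_const)
    (fun u _ => by simpa using hK)
  refine chron_of_curveRel ?_
  convert h using 1
  · refine ext_coords ?_ ?_ fun s => ?_ <;> simp
  · refine ext_coords ?_ ?_ fun s => ?_ <;> simp

lemma chron_sub_pt (p : PWCoord k l → ℝ) {K ε : ℝ}
    (hK : -(∑ s, freq μ m s * p (Sum.inr s) ^ 2) < 2 * K) (hε : 0 < ε) :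
    planeWaveChron μ m (p + pt (-ε) (-(K * ε)) 0) p := by
  have h := chron_translate (chron_add_pt p hK hε) (-ε) (-(K * ε))
  convert h using 1
  refine ext_coords ?_ ?_ fun s => ?_ <;> simp

lemma exists_slope (μ : Fin k → ℝ) (m : Fin l → ℝ) (p : PWCoord k l → ℝ) :
    ∃ K : ℝ, -(∑ s, freq μ m s * p (Sum.inr s) ^ 2) < 2 * K :=
  ⟨-(∑ s, freq μ m s * p (Sum.inr s) ^ 2) / 2 + 1, by linarith⟩

lemma tendsto_add_pt (p : PWCoord k l → ℝ) (K : ℝ) :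
    Tendsto (fun ε : ℝ => p + pt ε (K * ε) 0) (𝓝 0) (𝓝 p) := by
  have hc : Continuous fun ε : ℝ => p + pt ε (K * ε) 0 := by
    refine continuous_const.add (continuous_pi ?_)
    rw [forall_coord]
    refine ⟨?_, ?_, fun s => ?_⟩ <;> simp only [pt_zero, pt_one, pt_inr] <;> fun_prop
  have := hc.tendsto 0
  have e : p + pt 0 (K * 0) 0 = p := ext_coords (by simp) (by simp) (by simp)
  rwa [e] at this

lemma tendsto_sub_pt (p : PWCoord k l → ℝ) (K : ℝ) :
    Tendsto (fun ε : ℝ => p + pt (-ε) (-(K * ε)) 0) (𝓝 0) (𝓝 p) := by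
  have h := (tendsto_add_pt p K).comp (f := fun ε : ℝ => -ε)
    (by simpa using (continuous_neg.tendsto (0 : ℝ)))
  refine h.congr fun ε => ?_
  simp

lemma exists_chron_between {p q : PWCoord k l → ℝ} (h : planeWaveChron μ m p q) :
    ∃ r, planeWaveChron μ m p r ∧ planeWaveChron μ m r q := by
  obtain ⟨K, hK⟩ := exists_slope μ m q
  have h1 := (tendsto_sub_pt q K).eventually (chron_eventually_right h)
  obtain ⟨ε, hε, hε0⟩ := ((h1.filter_mono nhdsWithin_le_nhds).and
    (self_mem_nhdsWithin (s := Ioi (0 : ℝ)))).exists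
  exact ⟨_, hε, chron_sub_pt q hK hε0⟩

lemma rosenV_pt (lam c : Fin k ⊕ Fin l → ℝ) (u v : ℝ) (z : Fin k ⊕ Fin l → ℝ) :
    rosenV lam c (pt u v z) = v + rosenV lam c (pt u 0 z) := by simp [rosenV]

lemma rosenQ_nonneg {lam c : Fin k ⊕ Fin l → ℝ} {p q : PWCoord k l → ℝ}
    (h : p (Sum.inl 0) < q (Sum.inl 0))
    (hc : ∀ s, ∀ u ∈ Icc (p (Sum.inl 0)) (q (Sum.inl 0)), 0 < gcos (lam s) (u - c s)) :
    0 ≤ rosenQ lam c p q :=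
  Finset.sum_nonneg fun s _ => div_nonneg (sq_nonneg _) (sub_nonneg.2 (rosenT_lt h (hc s)).le)

lemma gcos_pos_of_mid {ν a b : ℝ} (hν : 0 < ν) (hle : ∀ s, freq μ m s ≤ ν ^ 2)
    (hab : b < a + Real.pi / ν) (s : Fin k ⊕ Fin l) {u : ℝ} (hu : u ∈ Icc a b) :
    0 < gcos (freq μ m s) (u - (a + b) / 2) := by
  refine gcos_pos hν (hle s) ?_
  have e : Real.pi / (2 * ν) = Real.pi / ν / 2 := by field_simp
  rw [e, abs_lt]
  constructor <;> linarith [hu.1, hu.2]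

/-- Before the focusing time Rosen coordinates centred at the midpoint cover the whole interval;
there `x⁻` enters only through an additive term in `V`. -/
lemma chron_short {ν : ℝ} (hν : 0 < ν) (hle : ∀ s, freq μ m s ≤ ν ^ 2) (p : PWCoord k l → ℝ)
    {u : ℝ} (h1 : p (Sum.inl 0) < u) (h2 : u < p (Sum.inl 0) + Real.pi / ν)
    (z : Fin k ⊕ Fin l → ℝ) :
    ∃ v₀, ∀ v ≥ v₀, planeWaveChron μ m p (pt u v z) := by
  set c : Fin k ⊕ Fin l → ℝ := fun _ => (p (Sum.inl 0) + u) / 2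
  refine ⟨rosenQ (freq μ m) c p (pt u 0 z) / 2 + rosenV (freq μ m) c p
    - rosenV (freq μ m) c (pt u 0 z) + 1, fun v hv => ?_⟩
  refine chron_of_rosenQ_lt (c := c) h1 (fun s u' hu' => gcos_pos_of_mid hν hle h2 s hu') ?_
  have e : rosenQ (freq μ m) c p (pt u v z) = rosenQ (freq μ m) c p (pt u 0 z) := by
    simp [rosenQ, rosenZ, rosenT]
  rw [e, rosenV_pt _ _ u v z]
  linarith

lemma exists_not_chron_short {ν : ℝ} (hν : 0 < ν) (hle : ∀ s, freq μ m s ≤ ν ^ 2)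
    (p : PWCoord k l → ℝ) {u : ℝ} (h2 : u < p (Sum.inl 0) + Real.pi / ν)
    (z : Fin k ⊕ Fin l → ℝ) : ∃ v, ¬ planeWaveChron μ m p (pt u v z) := by
  set c : Fin k ⊕ Fin l → ℝ := fun _ => (p (Sum.inl 0) + u) / 2
  refine ⟨rosenV (freq μ m) c p - rosenV (freq μ m) c (pt u 0 z), fun h => ?_⟩
  have hc (s u') (hu' : u' ∈ Icc (p (Sum.inl 0)) u) : 0 < gcos (freq μ m s) (u' - c s) :=
    gcos_pos_of_mid hν hle h2 s hu'
  have h3 := rosenQ_lt_of_chron h hc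
  have h4 := rosenQ_nonneg (lam := freq μ m) (chron_xplus_lt h) hc
  rw [rosenV_pt (v := _ - _)] at h3
  linarith

/-- A half-period of `K sin (w (u - a))` in the strongest mode fits between the endpoints with `w <
ν`, so its action is `K² (w² - ν²) (b - a) / 2 < 0`. A large amplitude `K` therefore reaches
arbitrarily low `x⁻`. -/
lemma chron_pt_zero_of_long {ν : ℝ} (hν : 0 < ν) {i : Fin k ⊕ Fin l}
    (hi : freq μ m i = ν ^ 2) {a b v₁ v₂ : ℝ} (hab : a + Real.pi / ν < b)
    (hv : v₂ ≤ v₁ + (b - a)) :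
    planeWaveChron μ m (pt a v₁ 0) (pt b v₂ 0) := by
  have hpi := Real.pi_pos
  have hπν : 0 < Real.pi / ν := by positivity
  have hT : 0 < b - a := by linarith
  set w := Real.pi / (b - a) with hw
  have hw0 : 0 < w := by positivity
  have hwν : w < ν := by
    rw [hw, div_lt_iff₀ hT]
    have : Real.pi / ν < b - a := by linarith
    rw [div_lt_iff₀ hν] at this
    linarith
  have hneg : (w ^ 2 - ν ^ 2) * (b - a) < 0 :=
    mul_neg_of_neg_of_pos (by nlinarith) hT
  -- The amplitude that makes the curve below end exactly at `v₂`. The term `b - a` comes from the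
  -- extra unit slope in `x⁻` that makes the curve strictly timelike.
  set K := √(4 * (v₂ - v₁ - (b - a)) / ((w ^ 2 - ν ^ 2) * (b - a))) with hK
  have hK2 : K ^ 2 * ((w ^ 2 - ν ^ 2) * (b - a)) = 4 * (v₂ - v₁ - (b - a)) := by
    rw [hK, Real.sq_sqrt (div_nonneg_of_nonpos (by linarith) hneg.le), div_mul_cancel₀ _ hneg.ne]
  have hlin (u : ℝ) : HasDerivAt (fun u : ℝ => w * (u - a)) w u := by
    simpa using ((hasDerivAt_id u).sub_const a).const_mul w
  have hlin2 (u : ℝ) : HasDerivAt (fun u : ℝ => 2 * w * (u - a)) (2 * w) u := by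
    simpa using ((hasDerivAt_id u).sub_const a).const_mul (2 * w)
  have h := curveRel_of_graph (μ := μ) (m := m) (a := a) (b := b) (by linarith)
    (v := fun u => v₁ + (K ^ 2 / 4 * ((w ^ 2 - ν ^ 2) * (u - a)
      + (w ^ 2 + ν ^ 2) / (2 * w) * Real.sin (2 * w * (u - a))) + (u - a)))
    (v' := fun u => K ^ 2 / 4 * ((w ^ 2 - ν ^ 2)
      + (w ^ 2 + ν ^ 2) * Real.cos (2 * w * (u - a))) + 1)
    (z := fun u => Pi.single i (K * Real.sin (w * (u - a))))
    (z' := fun u => Pi.single i (K * (Real.cos (w * (u - a)) * w)))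
    (fun u => ?_) (fun s u => ?_) (by fun_prop) (fun s => ?_) (fun u _ => ?_)
  · refine chron_of_curveRel ?_
    convert h using 1
    · simp [pt]
    · have e1 : 2 * w * (b - a) = 2 * Real.pi := by rw [hw]; field_simp
      have e2 : w * (b - a) = Real.pi := by rw [hw]; field_simp
      have e3 : v₁ + (K ^ 2 / 4 * ((w ^ 2 - ν ^ 2) * (b - a)) + (b - a)) = v₂ := by linarith
      simp [e1, e2, e3]
  · have h1 := ((((hasDerivAt_id u).sub_const a).const_mul (w ^ 2 - ν ^ 2)).add
      ((hlin2 u).sin.const_mul ((w ^ 2 + ν ^ 2) / (2 * w)))).const_mul (K ^ 2 / 4)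
    refine ((h1.add ((hasDerivAt_id u).sub_const a)).const_add v₁).congr_deriv ?_
    field_simp
  · by_cases hs : s = i
    · subst hs
      simpa using (hlin u).sin.const_mul K
    · simpa [Pi.single_apply, hs] using hasDerivAt_const u (0 : ℝ)
  · by_cases hs : s = i
    · subst hs
      simp only [Pi.single_eq_same]
      fun_prop
    · simpa [Pi.single_apply, hs] using continuous_const
  · have e (f g : ℝ) : ∑ s, ((Pi.single i f : Fin k ⊕ Fin l → ℝ) s ^ 2
        - freq μ m s * (Pi.single i g : Fin k ⊕ Fin l → ℝ) s ^ 2) = f ^ 2 - ν ^ 2 * g ^ 2 := by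
      rw [Finset.sum_eq_single i]
      · simp [hi]
      · intro s _ hs
        simp [hs]
      · simp
    have h2 : Real.cos (2 * w * (u - a)) = 2 * Real.cos (w * (u - a)) ^ 2 - 1 := by
      rw [mul_assoc, Real.cos_two_mul]
    have h3 := Real.sin_sq_add_cos_sq (w * (u - a))
    rw [e, h2, ← sub_pos]
    refine lt_of_lt_of_eq two_pos ?_
    linear_combination (-(ν ^ 2 * K ^ 2)) * h3

/-- Points whose `x⁺`-coordinates differ by more than `π / ν` are chronologically related. -/
lemma chron_of_long {ν : ℝ} (hν : 0 < ν) (hle : ∀ s, freq μ m s ≤ ν ^ 2) {i : Fin k ⊕ Fin l}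
    (hi : freq μ m i = ν ^ 2) {p q : PWCoord k l → ℝ}
    (h : p (Sum.inl 0) + Real.pi / ν < q (Sum.inl 0)) : planeWaveChron μ m p q := by
  have hpi := Real.pi_pos
  have hπν : 0 < Real.pi / ν := by positivity
  -- Initial and final hops of length `δ / 3` move onto `z = 0`, while the middle piece stays longer
  -- than `π / ν`.
  obtain ⟨δ, hδ0, hδ⟩ := exists_between (lt_min (sub_pos.2 h) hπν)
  have hδ1 := hδ.trans_le (min_le_left _ _)
  have hδ2 := hδ.trans_le (min_le_right _ _)
  obtain ⟨v₁, h1⟩ := chron_short hν hle p (u := p (Sum.inl 0) + δ / 3) (by linarith)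
    (by linarith) 0
  obtain ⟨v₂, h2⟩ := chron_short hν hle (timeReversal q) (u := -q (Sum.inl 0) + δ / 3)
    (by simp [timeReversal]; linarith) (by simp [timeReversal]; linarith) 0
  -- The choice `max v₂ (-v₁)` starts the last hop at `x⁻ ≤ v₁`, which the middle piece can reach.
  have h3 := chron_timeReversal (h2 (max v₂ (-v₁)) (le_max_left _ _))
  rw [timeReversal_timeReversal] at h3
  refine chron_trans (h1 v₁ le_rfl) (chron_trans ?_ h3)
  have e : timeReversal (pt (-q (Sum.inl 0) + δ / 3) (max v₂ (-v₁)) (0 : Fin k ⊕ Fin l → ℝ))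
      = pt (q (Sum.inl 0) - δ / 3) (-max v₂ (-v₁)) 0 := by
    refine ext_coords ?_ ?_ fun s => ?_ <;> simp [timeReversal]
    ring
  rw [e]
  refine chron_pt_zero_of_long hν hi (by linarith) ?_
  have := le_max_right v₂ (-v₁)
  linarith

lemma exists_chron_of_xplus_lt {ν : ℝ} (hν : 0 < ν) (hle : ∀ s, freq μ m s ≤ ν ^ 2)
    {i : Fin k ⊕ Fin l} (hi : freq μ m i = ν ^ 2) (p : PWCoord k l → ℝ) {u : ℝ}
    (h : p (Sum.inl 0) < u) :
    ∃ v₀, ∀ v ≥ v₀, planeWaveChron μ m p (pt u v 0) := by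
  have hpi := Real.pi_pos
  have hπν : 0 < Real.pi / ν := by positivity
  rcases lt_or_ge u (p (Sum.inl 0) + Real.pi / ν) with h1 | h1
  · exact chron_short hν hle p h h1 0
  · obtain ⟨v, hv⟩ := chron_short hν hle p (u := p (Sum.inl 0) + Real.pi / ν / 2)
      (by linarith) (by linarith) 0
    rcases lt_or_ge (p (Sum.inl 0) + Real.pi / ν) u with h2 | h2
    · exact ⟨0, fun v _ => chron_of_long hν hle hi h2⟩
    -- Exactly at distance `π / ν`, two hops of half that length are used.
    · obtain ⟨v', hv'⟩ := chron_short hν hle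
        (pt (p (Sum.inl 0) + Real.pi / ν / 2) v (0 : Fin k ⊕ Fin l → ℝ)) (u := u)
        (by simp; linarith) (by simp; linarith) 0
      exact ⟨v', fun w hw => chron_trans (hv v le_rfl) (hv' w hw)⟩

end PlaneWave

/-! ## Indecomposable sets and order reversal -/

section Indecomposable

variable {X : Type} {R : X → X → Prop}

@[simp] lemma mem_chronPast_singleton {p x : X} : x ∈ chronPast R {p} ↔ R x p := by
  simp [chronPast]

@[simp] lemma mem_chronFuture_singleton {p x : X} : x ∈ chronFuture R {p} ↔ R p x := by
  simp [chronFuture]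

lemma isIP_of_directed {P : Set X} (hne : P.Nonempty) (hP : IsPastSet R P)
    (hdir : ∀ a ∈ P, ∀ b ∈ P, ∃ c ∈ P, R a c ∧ R b c) (htr : ∀ {a b c}, R a b → R b c → R a c) :
    IsIP R P := by
  refine ⟨hne, hP, ?_⟩
  rintro P₁ P₂ ⟨S₁, rfl⟩ ⟨S₂, rfl⟩ h
  by_contra! hcon
  have h1 : ∃ a ∈ P, a ∉ chronPast R S₁ := by
    by_contra! h'
    exact hcon.1 (Subset.antisymm (h ▸ subset_union_left) h')
  have h2 : ∃ a ∈ P, a ∉ chronPast R S₂ := by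
    by_contra! h'
    exact hcon.2 (Subset.antisymm (h ▸ subset_union_right) h')
  obtain ⟨a, ha, ha'⟩ := h1
  obtain ⟨b, hb, hb'⟩ := h2
  obtain ⟨c, hc, hac, hbc⟩ := hdir a ha b hb
  rw [h] at hc
  rcases hc with ⟨s, hs, hcs⟩ | ⟨s, hs, hcs⟩
  · exact ha' ⟨s, hs, htr hac hcs⟩
  · exact hb' ⟨s, hs, htr hbc hcs⟩

lemma IsPastSet.mem_of_rel {P : Set X} (hP : IsPastSet R P)
    (htr : ∀ {a b c}, R a b → R b c → R a c) {a b : X} (hab : R a b) (hb : b ∈ P) : a ∈ P := by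
  obtain ⟨S, rfl⟩ := hP
  obtain ⟨s, hs, hbs⟩ := hb
  exact ⟨s, hs, htr hab hbs⟩

lemma IsPastSet.exists_rel {P : Set X} (hP : IsPastSet R P)
    (hdense : ∀ {a b}, R a b → ∃ c, R a c ∧ R c b) {a : X} (ha : a ∈ P) : ∃ b ∈ P, R a b := by
  obtain ⟨S, rfl⟩ := hP
  obtain ⟨s, hs, has⟩ := ha
  obtain ⟨b, hab, hbs⟩ := hdense has
  exact ⟨b, ⟨s, hs, hbs⟩, hab⟩

/-- Split the past set according to whether the witnessing later point lies in the future of `a`.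
The second piece cannot be everything, because it would have to contain `a` itself. -/
lemma IsIP.directed {P : Set X} (hP : IsIP R P) (htr : ∀ {a b c}, R a b → R b c → R a c)
    (hdense : ∀ {a b}, R a b → ∃ c, R a c ∧ R c b) {a b : X} (ha : a ∈ P) (hb : b ∈ P) :
    ∃ c ∈ P, R a c ∧ R b c := by
  obtain ⟨-, hpast, hind⟩ := hP
  have h : P = chronPast R {c | c ∈ P ∧ R a c} ∪ chronPast R {c | c ∈ P ∧ ¬ R a c} := by
    ext x
    constructor
    · intro hx
      obtain ⟨y, hy, hxy⟩ := hpast.exists_rel hdense hx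
      by_cases hay : R a y
      · exact Or.inl ⟨y, ⟨hy, hay⟩, hxy⟩
      · exact Or.inr ⟨y, ⟨hy, hay⟩, hxy⟩
    · rintro (⟨y, hy, hxy⟩ | ⟨y, hy, hxy⟩) <;> exact hpast.mem_of_rel htr hxy hy.1
  rcases hind _ _ ⟨_, rfl⟩ ⟨_, rfl⟩ h with h1 | h1
  · rw [← h1] at hb
    obtain ⟨c, ⟨hc, hac⟩, hbc⟩ := hb
    exact ⟨c, hc, hac, hbc⟩
  · rw [← h1] at ha
    obtain ⟨c, ⟨-, hac⟩, hac'⟩ := ha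
    exact absurd hac' hac

lemma SRelated.of_eq {P F : Set X} (hP : IsIP R P) (hF : IsIF R F) (h1 : commonPast R F = P)
    (h2 : commonFuture R P = F) : SRelated R P F :=
  ⟨⟨hP, h1.ge, fun _ _ h h' => (h'.trans h1.le).antisymm h⟩,
    ⟨hF, h2.ge, fun _ _ h h' => (h'.trans h2.le).antisymm h⟩⟩

/-- When the whole common past is itself an IP, it is the unique maximal one, so the future
component determines the past component. -/
lemma CausalCompletion.past_eq {Q : CausalCompletion R} {P : Set X} (hne : Q.future.Nonempty)
    (h : SRelated R P Q.future) (h1 : commonPast R Q.future = P) : Q.past = P := by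
  rcases Q.isPair with hQ | ⟨-, hQ, -⟩ | ⟨-, -, hQ⟩
  · exact (hQ.1.2.2 P h.1.1 (h1 ▸ hQ.1.2.1) h1.ge).symm
  · exact absurd hQ hne.ne_empty
  · exact absurd h (hQ P)

lemma CausalCompletion.isIF_future {Q : CausalCompletion R} (hne : Q.future.Nonempty) :
    IsIF R Q.future := by
  rcases Q.isPair with hQ | ⟨-, hQ, -⟩ | ⟨-, hQ, -⟩
  · exact hQ.2.1
  · exact absurd hQ hne.ne_empty
  · exact hQ

lemma CausalCompletion.past_nonempty_or_future_nonempty (Q : CausalCompletion R) :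
    Q.past.Nonempty ∨ Q.future.Nonempty := by
  rcases Q.isPair with hQ | ⟨hQ, -, -⟩ | ⟨-, hQ, -⟩
  · exact Or.inl hQ.1.1.1
  · exact Or.inl hQ.1
  · exact Or.inr hQ.1

lemma CausalCompletion.ext_sets {Q Q' : CausalCompletion R} (h : Q.past = Q'.past)
    (h' : Q.future = Q'.future) : Q = Q' := by
  cases Q; cases Q'; simp_all

end Indecomposable

/-! ### Order-reversing involutions acting on the completion -/

section Reversal

variable {X : Type} {R : X → X → Prop} {θ : X → X}

lemma chronPast_preimage (hθ : ∀ x, θ (θ x) = x) (hR : ∀ p q, R (θ q) (θ p) ↔ R p q)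
    (S : Set X) : chronPast R (θ ⁻¹' S) = θ ⁻¹' chronFuture R S := by
  ext x
  constructor
  · rintro ⟨s, hs, h⟩
    exact ⟨θ s, hs, (hR _ _).2 h⟩
  · rintro ⟨s, hs, h⟩
    refine ⟨θ s, by simpa [hθ] using hs, (hR _ _).1 ?_⟩
    rwa [hθ]

lemma chronFuture_preimage (hθ : ∀ x, θ (θ x) = x) (hR : ∀ p q, R (θ q) (θ p) ↔ R p q)
    (S : Set X) : chronFuture R (θ ⁻¹' S) = θ ⁻¹' chronPast R S :=
  chronPast_preimage (R := flip R) hθ (fun p q => hR q p) S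

lemma preimage_eq_iff_of_involutive (hθ : ∀ x, θ (θ x) = x) {S T : Set X} :
    θ ⁻¹' S = θ ⁻¹' T ↔ S = T :=
  preimage_eq_preimage (Function.RightInverse.surjective hθ)

lemma preimage_preimage_of_involutive (hθ : ∀ x, θ (θ x) = x) (S : Set X) :
    θ ⁻¹' (θ ⁻¹' S) = S := by
  ext x; simp [hθ]

lemma isPastSet_preimage (hθ : ∀ x, θ (θ x) = x) (hR : ∀ p q, R (θ q) (θ p) ↔ R p q)
    {S : Set X} : IsPastSet R (θ ⁻¹' S) ↔ IsFutureSet R S := by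
  constructor
  · rintro ⟨T, hT⟩
    refine ⟨θ ⁻¹' T, ?_⟩
    rw [chronFuture_preimage hθ hR, ← hT, preimage_preimage_of_involutive hθ]
  · rintro ⟨T, rfl⟩
    exact ⟨θ ⁻¹' T, (chronPast_preimage hθ hR T).symm⟩

lemma isIP_preimage (hθ : ∀ x, θ (θ x) = x) (hR : ∀ p q, R (θ q) (θ p) ↔ R p q)
    {F : Set X} : IsIP R (θ ⁻¹' F) ↔ IsIF R F := by
  have hs : Function.Surjective θ := Function.RightInverse.surjective hθ
  refine and_congr ?_ (and_congr (isPastSet_preimage hθ hR) ?_)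
  · exact ⟨fun ⟨x, hx⟩ => ⟨θ x, hx⟩, fun h => h.preimage hs⟩
  · constructor
    · intro h F₁ F₂ h1 h2 h3
      have := h _ _ ((isPastSet_preimage hθ hR).2 h1) ((isPastSet_preimage hθ hR).2 h2)
        (by rw [h3, preimage_union])
      simpa only [preimage_eq_iff_of_involutive hθ] using this
    · intro h P₁ P₂ h1 h2 h3
      rw [← preimage_preimage_of_involutive hθ P₁, isPastSet_preimage hθ hR] at h1
      rw [← preimage_preimage_of_involutive hθ P₂, isPastSet_preimage hθ hR] at h2
      have := h _ _ h1 h2 (by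
        rw [← preimage_union, ← h3, preimage_preimage_of_involutive hθ])
      rw [← preimage_eq_iff_of_involutive hθ, ← preimage_eq_iff_of_involutive hθ (S := θ ⁻¹' P₂),
        preimage_preimage_of_involutive hθ, preimage_preimage_of_involutive hθ] at this
      exact this

lemma isIF_preimage (hθ : ∀ x, θ (θ x) = x) (hR : ∀ p q, R (θ q) (θ p) ↔ R p q)
    {P : Set X} : IsIF R (θ ⁻¹' P) ↔ IsIP R P :=
  isIP_preimage (R := flip R) hθ (fun p q => hR q p)

lemma commonPast_preimage (hθ : ∀ x, θ (θ x) = x) (hR : ∀ p q, R (θ q) (θ p) ↔ R p q)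
    (F : Set X) : commonPast R (θ ⁻¹' F) = θ ⁻¹' commonFuture R F := by
  rw [commonPast, commonFuture, ← chronPast_preimage hθ hR]
  congr 1
  ext x
  constructor
  · intro h p hp
    rw [← hR, hθ]
    exact h (θ p) (by simpa [hθ] using hp)
  · intro h q hq
    rw [← hR]
    exact h _ hq

lemma commonFuture_preimage (hθ : ∀ x, θ (θ x) = x) (hR : ∀ p q, R (θ q) (θ p) ↔ R p q)
    (P : Set X) : commonFuture R (θ ⁻¹' P) = θ ⁻¹' commonPast R P :=
  commonPast_preimage (R := flip R) hθ (fun p q => hR q p) P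

lemma sRelated_preimage (hθ : ∀ x, θ (θ x) = x) (hR : ∀ p q, R (θ q) (θ p) ↔ R p q)
    {P F : Set X} (h : SRelated R P F) : SRelated R (θ ⁻¹' F) (θ ⁻¹' P) := by
  have hs : Function.Surjective θ := Function.RightInverse.surjective hθ
  obtain ⟨⟨hP, hPF, hPmax⟩, hF, hFP, hFmax⟩ := h
  refine ⟨⟨(isIP_preimage hθ hR).2 hF, ?_, fun P' hP' h1 h2 => ?_⟩,
    (isIF_preimage hθ hR).2 hP, ?_, fun F' hF' h1 h2 => ?_⟩
  · rw [commonPast_preimage hθ hR]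
    exact preimage_mono hFP
  · rw [← preimage_preimage_of_involutive hθ P'] at hP' h1 h2 ⊢
    rw [commonPast_preimage hθ hR] at h2
    rw [hFmax _ ((isIP_preimage hθ hR).1 hP') ((preimage_subset_preimage_iff (by
      rw [hs.range_eq]; exact subset_univ _)).1 h1) ((preimage_subset_preimage_iff (by
      rw [hs.range_eq]; exact subset_univ _)).1 h2)]
  · rw [commonFuture_preimage hθ hR]
    exact preimage_mono hPF
  · rw [← preimage_preimage_of_involutive hθ F'] at hF' h1 h2 ⊢
    rw [commonFuture_preimage hθ hR] at h2
    rw [hPmax _ ((isIF_preimage hθ hR).1 hF') ((preimage_subset_preimage_iff (by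
      rw [hs.range_eq]; exact subset_univ _)).1 h1) ((preimage_subset_preimage_iff (by
      rw [hs.range_eq]; exact subset_univ _)).1 h2)]

/-- The image of a point of the completion under an order reversing involution. -/
def CausalCompletion.reverse (hθ : ∀ x, θ (θ x) = x) (hR : ∀ p q, R (θ q) (θ p) ↔ R p q)
    (Q : CausalCompletion R) : CausalCompletion R where
  past := θ ⁻¹' Q.future
  future := θ ⁻¹' Q.past
  isPair := by
    have key {P F : Set X} (h : SRelated R (θ ⁻¹' F) (θ ⁻¹' P)) : SRelated R P F := by
      simpa only [preimage_preimage_of_involutive hθ] using sRelated_preimage hθ hR h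
    rcases Q.isPair with h | ⟨h, hF, h'⟩ | ⟨hP, h, h'⟩
    · exact Or.inl (sRelated_preimage hθ hR h)
    · refine Or.inr (Or.inr ⟨by rw [hF, preimage_empty], (isIF_preimage hθ hR).2 h,
        fun P' hP' => h' (θ ⁻¹' P') (key ?_)⟩)
      rwa [preimage_preimage_of_involutive hθ]
    · refine Or.inr (Or.inl ⟨(isIP_preimage hθ hR).2 h, by rw [hP, preimage_empty],
        fun F' hF' => h' (θ ⁻¹' F') (key ?_)⟩)
      rwa [preimage_preimage_of_involutive hθ]

end Reversal

/-! ## Indecomposable sets of plane waves -/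

namespace PlaneWave

variable {k l : ℕ} {μ : Fin k → ℝ} {m : Fin l → ℝ}

/-- The region `x⁺ < c`. -/
def lower (k l : ℕ) (c : ℝ) : Set (PWCoord k l → ℝ) := {p | p (Sum.inl 0) < c}

/-- The region `c < x⁺`. -/
def upper (k l : ℕ) (c : ℝ) : Set (PWCoord k l → ℝ) := {p | c < p (Sum.inl 0)}

lemma preimage_timeReversal_upper (c : ℝ) : timeReversal ⁻¹' upper k l c = lower k l (-c) := by
  ext p
  simp [upper, lower, timeReversal, lt_neg]

lemma preimage_timeReversal_lower (c : ℝ) : timeReversal ⁻¹' lower k l c = upper k l (-c) := by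
  ext p
  simp [upper, lower, timeReversal, neg_lt]

lemma preimage_timeReversal_singleton (p : PWCoord k l → ℝ) :
    timeReversal ⁻¹' {p} = {timeReversal p} := by
  ext x
  constructor
  · rintro rfl
    simp
  · rintro rfl
    simp

lemma preimage_timeReversal_chronPast (p : PWCoord k l → ℝ) :
    timeReversal ⁻¹' chronPast (planeWaveChron μ m) {p}
      = chronFuture (planeWaveChron μ m) {timeReversal p} := by
  rw [← preimage_timeReversal_singleton,
    chronFuture_preimage timeReversal_timeReversal fun _ _ => chron_timeReversal_iff]

lemma preimage_timeReversal_chronFuture (p : PWCoord k l → ℝ) :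
    timeReversal ⁻¹' chronFuture (planeWaveChron μ m) {p}
      = chronPast (planeWaveChron μ m) {timeReversal p} := by
  rw [← preimage_timeReversal_singleton,
    chronPast_preimage timeReversal_timeReversal fun _ _ => chron_timeReversal_iff]

lemma isIP_chronPast (p : PWCoord k l → ℝ) :
    IsIP (planeWaveChron μ m) (chronPast (planeWaveChron μ m) {p}) := by
  obtain ⟨K, hK⟩ := exists_slope μ m p
  refine isIP_of_directed ⟨_, mem_chronPast_singleton.2 (chron_sub_pt p hK one_pos)⟩ ⟨_, rfl⟩
    (fun a ha b hb => ?_) chron_trans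
  rw [mem_chronPast_singleton] at ha hb
  have h1 := (tendsto_sub_pt p K).eventually
    ((chron_eventually_right ha).and (chron_eventually_right hb))
  obtain ⟨ε, hε, hε0⟩ := ((h1.filter_mono nhdsWithin_le_nhds).and
    (self_mem_nhdsWithin (s := Ioi (0 : ℝ)))).exists
  exact ⟨_, mem_chronPast_singleton.2 (chron_sub_pt p hK hε0), hε⟩

lemma isIF_chronFuture (p : PWCoord k l → ℝ) :
    IsIF (planeWaveChron μ m) (chronFuture (planeWaveChron μ m) {p}) := by
  rw [← timeReversal_timeReversal p, ← preimage_timeReversal_chronPast,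
    isIF_preimage timeReversal_timeReversal fun _ _ => chron_timeReversal_iff]
  exact isIP_chronPast _

lemma commonPast_chronFuture (p : PWCoord k l → ℝ) :
    commonPast (planeWaveChron μ m) (chronFuture (planeWaveChron μ m) {p})
      = chronPast (planeWaveChron μ m) {p} := by
  ext y
  rw [mem_chronPast_singleton]
  constructor
  · rintro ⟨x, hx, hyx⟩
    obtain ⟨K, hK⟩ := exists_slope μ m p
    have h1 := (tendsto_sub_pt x K).eventually (chron_eventually_right hyx)
    obtain ⟨ε, hε, hε0⟩ := ((h1.filter_mono nhdsWithin_le_nhds).and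
      (self_mem_nhdsWithin (s := Ioi (0 : ℝ)))).exists
    refine chron_trans hε ?_
    -- Being below a point slightly later than `p` becomes, after translation, being below `p` from
    -- a slightly earlier point; openness of the relation absorbs that shift.
    have h2 := chron_translate (hx _ (mem_chronFuture_singleton.2 (chron_add_pt p hK hε0)))
      (-ε) (-(K * ε))
    convert h2 using 1
    refine ext_coords ?_ ?_ fun s => ?_ <;> simp
  · intro h
    obtain ⟨x, hyx, hxp⟩ := exists_chron_between h
    exact ⟨x, fun q hq => chron_trans hxp (mem_chronFuture_singleton.1 hq), hyx⟩

lemma commonFuture_chronPast (p : PWCoord k l → ℝ) :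
    commonFuture (planeWaveChron μ m) (chronPast (planeWaveChron μ m) {p})
      = chronFuture (planeWaveChron μ m) {p} := by
  rw [← timeReversal_timeReversal p, ← preimage_timeReversal_chronFuture,
    commonFuture_preimage timeReversal_timeReversal fun _ _ => chron_timeReversal_iff,
    commonPast_chronFuture, preimage_timeReversal_chronPast]

lemma sRelated_point (p : PWCoord k l → ℝ) :
    SRelated (planeWaveChron μ m) (chronPast (planeWaveChron μ m) {p})
      (chronFuture (planeWaveChron μ m) {p}) :=
  SRelated.of_eq (isIP_chronPast p) (isIF_chronFuture p) (commonPast_chronFuture p)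
    (commonFuture_chronPast p)

/-! ### Half-spaces as indecomposable sets -/

section HalfSpace

variable {ν : ℝ} {i : Fin k ⊕ Fin l}

lemma isIP_lower (hν : 0 < ν) (hle : ∀ s, freq μ m s ≤ ν ^ 2) (hi : freq μ m i = ν ^ 2) (c : ℝ) :
    IsIP (planeWaveChron μ m) (lower k l c) := by
  have hdir (a b : PWCoord k l → ℝ) (ha : a ∈ lower k l c) (hb : b ∈ lower k l c) :
      ∃ d ∈ lower k l c, planeWaveChron μ m a d ∧ planeWaveChron μ m b d := by
    obtain ⟨u, hu, huc⟩ := exists_between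
      (show max (a (Sum.inl 0)) (b (Sum.inl 0)) < c from max_lt ha hb)
    obtain ⟨v₁, h1⟩ := exists_chron_of_xplus_lt hν hle hi a ((le_max_left _ _).trans_lt hu)
    obtain ⟨v₂, h2⟩ := exists_chron_of_xplus_lt hν hle hi b ((le_max_right _ _).trans_lt hu)
    exact ⟨pt u (max v₁ v₂) 0, huc, h1 _ (le_max_left _ _), h2 _ (le_max_right _ _)⟩
  refine isIP_of_directed ⟨pt (c - 1) 0 0, by simp [lower]⟩ ⟨lower k l c, ?_⟩
    (fun a ha b hb => hdir a b ha hb) chron_trans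
  ext x
  constructor
  · intro hx
    obtain ⟨d, hd, h, -⟩ := hdir x x hx hx
    exact ⟨d, hd, h⟩
  · rintro ⟨d, hd, h⟩
    exact (chron_xplus_lt h).trans hd

lemma isIF_upper (hν : 0 < ν) (hle : ∀ s, freq μ m s ≤ ν ^ 2) (hi : freq μ m i = ν ^ 2) (c : ℝ) :
    IsIF (planeWaveChron μ m) (upper k l c) := by
  rw [← neg_neg c, ← preimage_timeReversal_lower,
    isIF_preimage timeReversal_timeReversal fun _ _ => chron_timeReversal_iff]
  exact isIP_lower hν hle hi _

/-- The delay is sharp: from a point later than `c - π / ν`, some level `x⁺ = u` above `c` is still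
within the focusing time and contains unreachable points, whereas beyond the focusing time
everything is reachable. -/
lemma commonPast_upper (hν : 0 < ν) (hle : ∀ s, freq μ m s ≤ ν ^ 2) (hi : freq μ m i = ν ^ 2)
    (c : ℝ) : commonPast (planeWaveChron μ m) (upper k l c) = lower k l (c - Real.pi / ν) := by
  have hπν : 0 < Real.pi / ν := div_pos Real.pi_pos hν
  ext y
  constructor
  · rintro ⟨x, hx, hyx⟩
    refine (chron_xplus_lt hyx).trans_le ?_
    by_contra! hlt
    obtain ⟨u, hu, hu'⟩ := exists_between (show max c (x (Sum.inl 0))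
      < x (Sum.inl 0) + Real.pi / ν from max_lt (by linarith) (by linarith))
    obtain ⟨v, hv⟩ := exists_not_chron_short hν hle x hu' 0
    exact hv (hx _ ((le_max_left _ _).trans_lt hu))
  · intro hy
    obtain ⟨u, hu, hu'⟩ := exists_between (show y (Sum.inl 0) < c - Real.pi / ν from hy)
    obtain ⟨v, hv⟩ := exists_chron_of_xplus_lt hν hle hi y hu
    refine ⟨pt u v 0, fun q hq => chron_of_long hν hle hi ?_, hv v le_rfl⟩
    have : c < q (Sum.inl 0) := hq
    rw [pt_zero]
    linarith

lemma commonFuture_lower (hν : 0 < ν) (hle : ∀ s, freq μ m s ≤ ν ^ 2) (hi : freq μ m i = ν ^ 2)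
    (c : ℝ) : commonFuture (planeWaveChron μ m) (lower k l c) = upper k l (c + Real.pi / ν) := by
  rw [← neg_neg c, ← preimage_timeReversal_upper,
    commonFuture_preimage timeReversal_timeReversal fun _ _ => chron_timeReversal_iff,
    commonPast_upper hν hle hi, preimage_timeReversal_lower]
  congr 1
  ring

lemma sRelated_halfSpaces (hν : 0 < ν) (hle : ∀ s, freq μ m s ≤ ν ^ 2)
    (hi : freq μ m i = ν ^ 2) (c : ℝ) :
    SRelated (planeWaveChron μ m) (lower k l (c - Real.pi / ν)) (upper k l c) := by
  refine SRelated.of_eq (isIP_lower hν hle hi _) (isIF_upper hν hle hi _)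
    (commonPast_upper hν hle hi c) ?_
  rw [commonFuture_lower hν hle hi, sub_add_cancel]

end HalfSpace

/-! ### Classification -/

/-- Joint convexity of `a² / s`. It gives both the triangle inequality for `rosenQ` and the weighted
version below. -/
lemma add_sq_div_add_le {a b s t : ℝ} (hs : 0 < s) (ht : 0 < t) :
    (a + b) ^ 2 / (s + t) ≤ a ^ 2 / s + b ^ 2 / t := by
  rw [div_add_div _ _ hs.ne' ht.ne', div_le_div_iff₀ (by positivity) (by positivity)]
  nlinarith [sq_nonneg (a * t - b * s)]

lemma rosenQ_triangle {lam c : Fin k ⊕ Fin l → ℝ} {p q r : PWCoord k l → ℝ}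
    (h1 : ∀ s, rosenT lam c p s < rosenT lam c q s)
    (h2 : ∀ s, rosenT lam c q s < rosenT lam c r s) :
    rosenQ lam c p r ≤ rosenQ lam c p q + rosenQ lam c q r := by
  rw [rosenQ, rosenQ, rosenQ, ← Finset.sum_add_distrib]
  refine Finset.sum_le_sum fun s _ => ?_
  have := add_sq_div_add_le (a := rosenZ lam c q s - rosenZ lam c p s)
    (b := rosenZ lam c r s - rosenZ lam c q s) (sub_pos.2 (h1 s)) (sub_pos.2 (h2 s))
  rw [sub_add_sub_cancel', sub_add_sub_cancel'] at this
  exact this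

/-- If `T` is bounded above, `rosenQ p r` grows strictly slower than `rosenQ q r`. -/
lemma exists_rosenQ_le {lam c : Fin k ⊕ Fin l → ℝ} {p q : PWCoord k l → ℝ}
    (h1 : ∀ s, rosenT lam c p s < rosenT lam c q s) (M : Fin k ⊕ Fin l → ℝ) :
    ∃ η > 0, ∃ C : ℝ, ∀ r, (∀ s, rosenT lam c q s < rosenT lam c r s) →
      (∀ s, rosenT lam c r s - rosenT lam c q s ≤ M s) →
      rosenQ lam c p r ≤ rosenQ lam c q r / (1 + η) + C := by
  have hη : ∀ᶠ η in 𝓝 (0 : ℝ), ∀ s, η * M s < (rosenT lam c q s - rosenT lam c p s) / 2 := by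
    refine eventually_all.2 fun s => ?_
    have hc : Continuous fun η : ℝ => η * M s := by fun_prop
    refine hc.continuousAt.eventually_lt continuousAt_const ?_
    have := sub_pos.2 (h1 s)
    simp only [zero_mul]
    positivity
  obtain ⟨η, hη, hη0⟩ := ((hη.filter_mono nhdsWithin_le_nhds).and
    (self_mem_nhdsWithin (s := Ioi (0 : ℝ)))).exists
  have hη0' : 0 < η := hη0
  refine ⟨η, hη0, ∑ s, (rosenZ lam c q s - rosenZ lam c p s) ^ 2
    / ((rosenT lam c q s - rosenT lam c p s) / 2), fun r hr hrM => ?_⟩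
  rw [rosenQ, rosenQ, Finset.sum_div, ← Finset.sum_add_distrib]
  refine Finset.sum_le_sum fun s _ => ?_
  have hD := sub_pos.2 (h1 s)
  have hS := sub_pos.2 (hr s)
  -- Half of the gap in `T` between `p` and `q` pays for the constant; the other half lengthens the
  -- denominator of the main term by the factor `1 + η`, which the bound `M` permits.
  have hle := add_sq_div_add_le (a := rosenZ lam c r s - rosenZ lam c q s)
    (b := rosenZ lam c q s - rosenZ lam c p s)
    (s := (rosenT lam c r s - rosenT lam c q s) * (1 + η))
    (t := (rosenT lam c q s - rosenT lam c p s) / 2) (by positivity) (by positivity)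
  rw [div_div]
  refine le_trans ?_ hle
  rw [sub_add_sub_cancel]
  refine div_le_div_of_nonneg_left (sq_nonneg _) (by positivity) ?_
  have h3 : (rosenT lam c r s - rosenT lam c q s) * η ≤ M s * η :=
    mul_le_mul_of_nonneg_right (hrM s) hη0'.le
  have h4 := hη s
  linarith

/-- An indecomposable past set on which `x⁺` is bounded above is the past of a point, or a
region `x⁺ < c`. -/
lemma isIP_eq_of_bounded {ν : ℝ} {i : Fin k ⊕ Fin l} (hν : 0 < ν)
    (hle : ∀ s, freq μ m s ≤ ν ^ 2) (hi : freq μ m i = ν ^ 2) {P : Set (PWCoord k l → ℝ)}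
    (hP : IsIP (planeWaveChron μ m) P) {b₀ : ℝ} (hb₀ : P ⊆ lower k l b₀) :
    (∃ p, P = chronPast (planeWaveChron μ m) {p}) ∨ ∃ c, P = lower k l c := by
  have hpast := hP.2.1
  have hdir {a b} (ha : a ∈ P) (hb : b ∈ P) := hP.directed chron_trans exists_chron_between ha hb
  set c := sSup ((fun p : PWCoord k l → ℝ => p (Sum.inl 0)) '' P) with hc
  have hbdd : BddAbove ((fun p : PWCoord k l → ℝ => p (Sum.inl 0)) '' P) := by
    refine ⟨b₀, ?_⟩
    rintro _ ⟨p, hp, rfl⟩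
    exact (hb₀ hp).le
  have hlt (x) (hx : x ∈ P) : x (Sum.inl 0) < c := by
    obtain ⟨y, hy, hxy⟩ := hpast.exists_rel exists_chron_between hx
    exact (chron_xplus_lt hxy).trans_le (le_csSup hbdd ⟨y, hy, rfl⟩)
  have hclose (d : ℝ) (hd : d < c) : ∃ x ∈ P, d < x (Sum.inl 0) := by
    obtain ⟨_, ⟨x, hx, rfl⟩, hdx⟩ := exists_lt_of_lt_csSup (hP.1.image _) hd
    exact ⟨x, hx, hdx⟩
  set r := Real.pi / (2 * ν) with hr
  have hr0 : 0 < r := by have := Real.pi_pos; positivity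
  set lam := freq μ m with hlam
  -- Centring all modes at the supremum `c` of `x⁺` makes `T = 0` and `(V, Z) = (x⁻, z)` on the
  -- level `x⁺ = c`, and keeps `T < 0` just below it.
  set cen : Fin k ⊕ Fin l → ℝ := fun _ => c with hcen
  have hgcos {s u} (hu : c - r < u) (hu' : u < c + r) : 0 < gcos (lam s) (u - cen s) := by
    refine gcos_pos hν (hle s) ?_
    rw [abs_lt]
    constructor <;> simp only [hcen] <;> linarith
  have hrel {x y} (hx : c - r < x (Sum.inl 0)) (hy : y (Sum.inl 0) ≤ c)
      (hxy : x (Sum.inl 0) < y (Sum.inl 0)) (s) : rosenT lam cen x s < rosenT lam cen y s :=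
    rosenT_lt hxy fun u hu => hgcos (hx.trans_le hu.1) (by linarith [hu.2])
  have hQ {x y} (hx : c - r < x (Sum.inl 0)) (hy : y (Sum.inl 0) ≤ c)
      (hxy : planeWaveChron μ m x y) :
      rosenQ lam cen x y < 2 * (rosenV lam cen y - rosenV lam cen x) :=
    rosenQ_lt_of_chron hxy fun s u hu => hgcos (hx.trans_le hu.1) (by linarith [hu.2])
  have hQ' {x y} (hx : c - r < x (Sum.inl 0)) (hy : y (Sum.inl 0) ≤ c)
      (hxy : x (Sum.inl 0) < y (Sum.inl 0))
      (h : rosenQ lam cen x y < 2 * (rosenV lam cen y - rosenV lam cen x)) :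
      planeWaveChron μ m x y :=
    chron_of_rosenQ_lt hxy (fun s u hu => hgcos (hx.trans_le hu.1) (by linarith [hu.2])) h
  have hQ0 {x y} (hx : c - r < x (Sum.inl 0)) (hy : y (Sum.inl 0) ≤ c)
      (hxy : x (Sum.inl 0) < y (Sum.inl 0)) (s) :
      (rosenZ lam cen y s - rosenZ lam cen x s) ^ 2 / (rosenT lam cen y s - rosenT lam cen x s)
        ≤ rosenQ lam cen x y :=
    Finset.single_le_sum (f := fun s => (rosenZ lam cen y s - rosenZ lam cen x s) ^ 2
        / (rosenT lam cen y s - rosenT lam cen x s))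
      (fun s _ => div_nonneg (sq_nonneg _) (sub_nonneg.2 (hrel hx hy hxy s).le))
      (Finset.mem_univ s)
  have hVlt {x y} (hx : c - r < x (Sum.inl 0)) (hy : y (Sum.inl 0) ≤ c)
      (hxy : planeWaveChron μ m x y) : rosenV lam cen x < rosenV lam cen y := by
    have h1 := hQ hx hy hxy
    have h2 := rosenQ_nonneg (lam := lam) (c := cen) (chron_xplus_lt hxy)
      fun s u hu => hgcos (hx.trans_le hu.1) (by linarith [hu.2])
    linarith
  have hTneg {x} (hx : c - r < x (Sum.inl 0)) (hxc : x (Sum.inl 0) < c) (s) :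
      rosenT lam cen x s < 0 := by
    have := hrel (y := pt c 0 0) hx le_rfl hxc s
    simpa [rosenT, hcen] using this
  obtain ⟨a₀, ha₀, ha₀r⟩ := hclose (c - r) (by linarith)
  -- The dichotomy: bounded `V` makes the directed set converge to an endpoint `p`; unbounded `V`
  -- lets it swallow the whole half-space.
  by_cases hV : BddAbove (rosenV lam cen '' {x | x ∈ P ∧ c - r < x (Sum.inl 0)})
  · left
    set V₀ := sSup (rosenV lam cen '' {x | x ∈ P ∧ c - r < x (Sum.inl 0)}) with hV₀
    have hVne : (rosenV lam cen '' {x | x ∈ P ∧ c - r < x (Sum.inl 0)}).Nonempty :=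
      ⟨_, a₀, ⟨ha₀, ha₀r⟩, rfl⟩
    have hVle {x} (hx : x ∈ P) (hxr : c - r < x (Sum.inl 0)) : rosenV lam cen x ≤ V₀ :=
      le_csSup hV ⟨x, ⟨hx, hxr⟩, rfl⟩
    -- The filter of eventually later points of `P`; directedness makes these sets a basis. Along it
    -- `x⁺` and `V` tend to their suprema by monotonicity.
    set L : Filter (PWCoord k l → ℝ) := ⨅ a ∈ P, 𝓟 (P ∩ {b | planeWaveChron μ m a b}) with hL
    have hLb : L.HasBasis (fun a => a ∈ P) (fun a => P ∩ {b | planeWaveChron μ m a b}) := by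
      refine hasBasis_biInf_principal ?_ hP.1
      intro a ha b hb
      obtain ⟨d, hd, had, hbd⟩ := hdir ha hb
      exact ⟨d, hd, fun x hx => ⟨hx.1, chron_trans had hx.2⟩,
        fun x hx => ⟨hx.1, chron_trans hbd hx.2⟩⟩
    have hLne : L.NeBot := by
      rw [hLb.neBot_iff]
      intro a ha
      obtain ⟨b, hb, hab⟩ := hpast.exists_rel exists_chron_between ha
      exact ⟨b, hb, hab⟩
    have hev {a} (ha : a ∈ P) : ∀ᶠ b in L, b ∈ P ∧ planeWaveChron μ m a b :=
      hLb.mem_of_mem ha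
    have hu : Tendsto (fun x : PWCoord k l → ℝ => x (Sum.inl 0)) L (𝓝 c) := by
      refine tendsto_order.2 ⟨fun d hd => ?_, fun d hd => ?_⟩
      · obtain ⟨x, hx, hdx⟩ := hclose d hd
        filter_upwards [hev hx] with b hb
        exact hdx.trans (chron_xplus_lt hb.2)
      · filter_upwards [hev ha₀] with b hb
        exact (hlt b hb.1).trans hd
    have hVt : Tendsto (rosenV lam cen) L (𝓝 V₀) := by
      refine tendsto_order.2 ⟨fun d hd => ?_, fun d hd => ?_⟩
      · obtain ⟨_, ⟨x, ⟨hx, hxr⟩, rfl⟩, hdx⟩ := exists_lt_of_lt_csSup hVne hd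
        filter_upwards [hev hx] with b hb
        exact hdx.trans (hVlt hxr (hlt b hb.1).le hb.2)
      · filter_upwards [hev ha₀] with b hb
        exact (hVle hb.1 (ha₀r.trans (chron_xplus_lt hb.2))).trans_lt hd
    have hZ (s) : ∃ Z, Tendsto (fun x => rosenZ lam cen x s) L (𝓝 Z) := by
      refine CompleteSpace.complete (Metric.cauchy_iff.2 ⟨hLne.map _, fun ε hε => ?_⟩)
      set M := -rosenT lam cen a₀ s with hM
      have hM0 : 0 < M := neg_pos.2 (hTneg ha₀r (hlt _ ha₀) s)
      -- Later points satisfy `(ΔZ)² < 2 ΔV ΔT` with `ΔT < M`. This tolerance for `V` bounds the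
      -- right side by `ε² / 8`, which is below `(ε / 2)²`.
      have hδ : V₀ - ε ^ 2 / (16 * M) < V₀ := by
        have : 0 < ε ^ 2 / (16 * M) := by positivity
        linarith
      obtain ⟨_, ⟨a₁, ⟨ha₁, ha₁r⟩, rfl⟩, hVa₁⟩ := exists_lt_of_lt_csSup hVne hδ
      obtain ⟨a, ha, h0a, h1a⟩ := hdir ha₀ ha₁
      have har : c - r < a (Sum.inl 0) := ha₀r.trans (chron_xplus_lt h0a)
      have hVa := hVlt ha₁r (hlt a ha).le h1a
      have hest (b) (hb : b ∈ P ∧ planeWaveChron μ m a b) :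
          |rosenZ lam cen b s - rosenZ lam cen a s| < ε / 2 := by
        have hbc := (hlt b hb.1).le
        have hab := chron_xplus_lt hb.2
        have h1 := (hQ0 har hbc hab s).trans_lt (hQ har hbc hb.2)
        have hT0 := sub_pos.2 (hrel har hbc hab s)
        rw [div_lt_iff₀ hT0] at h1
        have hTb := hTneg (har.trans hab) (hlt b hb.1) s
        have hTa := hrel ha₀r (hlt a ha).le (chron_xplus_lt h0a) s
        have hVb := hVle hb.1 (har.trans hab)
        have h2 : 2 * (rosenV lam cen b - rosenV lam cen a) < 2 * (ε ^ 2 / (16 * M)) := by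
          linarith
        have h3 : 2 * (rosenV lam cen b - rosenV lam cen a)
            * (rosenT lam cen b s - rosenT lam cen a s) < 2 * (ε ^ 2 / (16 * M)) * M :=
          mul_lt_mul h2 (by linarith) hT0 (by positivity)
        have h4 : 2 * (ε ^ 2 / (16 * M)) * M = ε ^ 2 / 8 := by field_simp; norm_num
        refine abs_lt_of_sq_lt_sq ?_ (by positivity)
        nlinarith
      refine ⟨(fun x => rosenZ lam cen x s) '' (P ∩ {b | planeWaveChron μ m a b}),
        image_mem_map (hLb.mem_of_mem ha), ?_⟩
      rintro _ ⟨b, hb, rfl⟩ _ ⟨b', hb', rfl⟩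
      have h1 := abs_lt.1 (hest b hb)
      have h2 := abs_lt.1 (hest b' hb')
      rw [Real.dist_eq, abs_lt]
      constructor <;> linarith [h1.1, h1.2, h2.1, h2.2]
    choose Z₀ hZ₀ using hZ
    set p : PWCoord k l → ℝ := pt c V₀ Z₀ with hp
    have hpV : rosenV lam cen p = V₀ := by simp [rosenV, hp, hcen]
    have hpZ (s) : rosenZ lam cen p s = Z₀ s := by simp [rosenZ, hp, hcen]
    have hpT (s) : rosenT lam cen p s = 0 := by simp [rosenT, hp, hcen]
    have husub (s) : Tendsto (fun x : PWCoord k l → ℝ => x (Sum.inl 0) - cen s) L (𝓝 0) := by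
      simpa [hcen] using hu.sub_const c
    have hCt (s) : Tendsto (fun x : PWCoord k l → ℝ => gcos (lam s) (x (Sum.inl 0) - cen s))
        L (𝓝 1) := by
      have := ((continuous_gcos (lam s)).tendsto 0).comp (husub s)
      rwa [gcos_zero] at this
    have hTt (s) : Tendsto (fun x => rosenT lam cen x s) L (𝓝 0) := by
      have := ((hasDerivAt_gtan (lam := lam s) (u := 0) (by simp)).continuousAt.tendsto).comp
        (husub s)
      rwa [gtan_zero] at this
    have hzt (s) : Tendsto (fun x : PWCoord k l → ℝ => x (Sum.inr s)) L (𝓝 (Z₀ s)) := by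
      have h1 := (hZ₀ s).mul (hCt s)
      rw [mul_one] at h1
      refine h1.congr' ?_
      filter_upwards [hev ha₀] with b hb
      have := (hgcos (s := s) (ha₀r.trans (chron_xplus_lt hb.2))
        (by linarith [hlt b hb.1])).ne'
      rw [rosenZ, div_mul_cancel₀ _ this]
    have hvt : Tendsto (fun x : PWCoord k l → ℝ => x (Sum.inl 1)) L (𝓝 V₀) := by
      have h1 : Tendsto (fun x : PWCoord k l → ℝ => rosenV lam cen x
          - 1 / 2 * ∑ s, lam s * rosenT lam cen x s * x (Sum.inr s) ^ 2) L
          (𝓝 (V₀ - 1 / 2 * ∑ s, lam s * 0 * Z₀ s ^ 2)) :=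
        hVt.sub ((tendsto_finsetSum _ fun s _ =>
          ((hTt s).const_mul (lam s)).mul ((hzt s).pow 2)).const_mul _)
      simp only [mul_zero, zero_mul, Finset.sum_const_zero, sub_zero] at h1
      refine h1.congr fun x => ?_
      simp [rosenV, rosenT]
    have hid : Tendsto (fun x => x) L (𝓝 p) := by
      refine tendsto_pi_nhds.2 ?_
      rw [forall_coord]
      exact ⟨hu, hvt, hzt⟩
    refine ⟨p, Subset.antisymm (fun x hx => ?_) fun x hx => ?_⟩
    · rw [mem_chronPast_singleton]
      obtain ⟨x₁, hx₁, hxx₁, ha₁⟩ := hdir hx ha₀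
      obtain ⟨x₂, hx₂, hx₁₂⟩ := hpast.exists_rel exists_chron_between hx₁
      have hr₁ : c - r < x₁ (Sum.inl 0) := ha₀r.trans (chron_xplus_lt ha₁)
      have hr₂ : c - r < x₂ (Sum.inl 0) := hr₁.trans (chron_xplus_lt hx₁₂)
      refine chron_trans hxx₁ (hQ' hr₁ le_rfl (hlt _ hx₁) ?_)
      have h1 := hQ hr₁ (hlt _ hx₂).le hx₁₂
      -- Passing to the limit loses strictness; the strict inequality from `x₁` to `x₂` restores it
      -- through the triangle inequality.
      have h2 : rosenQ lam cen x₂ p ≤ 2 * (rosenV lam cen p - rosenV lam cen x₂) := by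
        rw [hpV]
        refine le_of_tendsto_of_tendsto (b := L) (f := fun b => rosenQ lam cen x₂ b)
          (g := fun b => 2 * (rosenV lam cen b - rosenV lam cen x₂)) ?_
          ((hVt.sub_const _).const_mul 2) ?_
        · refine tendsto_finsetSum _ fun s _ => ?_
          rw [hpZ, hpT]
          refine (((hZ₀ s).sub_const _).pow 2).div ((hTt s).sub_const _) ?_
          rw [zero_sub]
          exact (neg_pos.2 (hTneg hr₂ (hlt _ hx₂) s)).ne'
        · filter_upwards [hev hx₂] with b hb
          exact (hQ hr₂ (hlt _ hb.1).le hb.2).le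
      have h3 := rosenQ_triangle (hrel hr₁ (hlt _ hx₂).le (chron_xplus_lt hx₁₂))
        (hrel (y := p) hr₂ le_rfl (hlt _ hx₂))
      linarith
    · rw [mem_chronPast_singleton] at hx
      obtain ⟨b, hb, hxb⟩ := ((hev ha₀).and (hid.eventually (chron_eventually_right hx))).exists
      exact hpast.mem_of_rel chron_trans hxb hb.1
  · right
    refine ⟨c, Subset.antisymm hlt fun x hx => ?_⟩
    obtain ⟨u, hu, huc⟩ := exists_between (max_lt hx (show c - r < c by linarith))
    obtain ⟨v, hv⟩ := exists_chron_of_xplus_lt hν hle hi x ((le_max_left _ _).trans_lt hu)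
    refine hpast.mem_of_rel chron_trans (hv v le_rfl) ?_
    set y : PWCoord k l → ℝ := pt u v 0 with hy
    have hyr : c - r < y (Sum.inl 0) := (le_max_right _ _).trans_lt hu
    obtain ⟨a, ha, hya⟩ := hclose u huc
    have har : c - r < a (Sum.inl 0) := hyr.trans hya
    obtain ⟨η, hη, C, hC⟩ := exists_rosenQ_le (hrel hyr (hlt a ha).le hya)
      (fun s => -rosenT lam cen a s)
    rw [not_bddAbove_iff] at hV
    -- The threshold is where `2 (V_b - V_a) / (1 + η) + C` drops below `2 (V_b - V_y)`; the factor
    -- `1 + η` makes this happen once `V_b` is large.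
    obtain ⟨_, ⟨b₁, ⟨hb₁, hb₁r⟩, rfl⟩, hN⟩ := hV ((C * (1 + η)
      + 2 * (1 + η) * rosenV lam cen y - 2 * rosenV lam cen a) / (2 * η))
    obtain ⟨b, hb, hab, hbb⟩ := hdir ha hb₁
    have hbr : c - r < b (Sum.inl 0) := hb₁r.trans (chron_xplus_lt hbb)
    have hVb := hVlt hb₁r (hlt b hb).le hbb
    have hab' := chron_xplus_lt hab
    refine hpast.mem_of_rel chron_trans (hQ' hyr (hlt b hb).le (hya.trans hab') ?_) hb
    have h1 := hC b (hrel har (hlt b hb).le hab') fun s => by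
      linarith [hTneg hbr (hlt b hb) s]
    have h2 := hQ har (hlt b hb).le hab
    refine h1.trans_lt ?_
    rw [div_lt_iff₀ (by positivity)] at hN
    have h3 : rosenQ lam cen a b / (1 + η)
        < 2 * (rosenV lam cen b - rosenV lam cen a) / (1 + η) := by gcongr
    refine (add_lt_add_left h3 C).trans_le ?_
    rw [div_add' _ _ _ (by positivity), div_le_iff₀ (by positivity)]
    nlinarith

end PlaneWave

/-! ## The limit operators on a spacelike line -/

namespace CausalCompletion

variable {X : Type} [TopologicalSpace X] {R : X → X → Prop}

lemma isClosed_Lplus (S : Set (CausalCompletion R)) : IsClosed (Lplus S) :=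
  ⟨TopologicalSpace.isOpen_generateFrom_of_mem ⟨S, Or.inl rfl⟩⟩

lemma isClosed_Lminus (S : Set (CausalCompletion R)) : IsClosed (Lminus S) :=
  ⟨TopologicalSpace.isOpen_generateFrom_of_mem ⟨S, Or.inr rfl⟩⟩

lemma subset_Lplus (S : Set (CausalCompletion R)) : S ⊆ Lplus S := fun _ h => Or.inl (Or.inl h)

lemma subset_Lminus (S : Set (CausalCompletion R)) : S ⊆ Lminus S := fun _ h => Or.inl (Or.inl h)

end CausalCompletion

namespace PlaneWave

open CausalCompletion

variable {k l : ℕ} {μ : Fin k → ℝ} {m : Fin l → ℝ} {ν : ℝ} {i j : Fin k ⊕ Fin l}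

/-- The point whose only possibly nonzero coordinate is the transverse coordinate `z_j = t`. -/
def axisPoint (j : Fin k ⊕ Fin l) (t : ℝ) : PWCoord k l → ℝ := pt 0 0 (Pi.single j t)

lemma xAxisPoint_eq (j : Fin k) (t : ℝ) :
    (xAxisPoint j t : PWCoord k l → ℝ) = axisPoint (Sum.inl j) t := by
  refine ext_coords ?_ ?_ fun s => ?_
  · simp [xAxisPoint, axisPoint]
  · simp [xAxisPoint, axisPoint]
  · by_cases hs : s = Sum.inl j
    · subst hs
      simp [xAxisPoint, axisPoint]
    · simp [xAxisPoint, axisPoint, hs]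

lemma timeReversal_axisPoint (t : ℝ) :
    timeReversal (axisPoint j t) = axisPoint j t := by
  refine ext_coords ?_ ?_ fun s => ?_ <;> simp [timeReversal, axisPoint]

/-- The chronological future of the part of the `z_j`-axis over `B`. -/
def axisFuture (μ : Fin k → ℝ) (m : Fin l → ℝ) (j : Fin k ⊕ Fin l) (B : Set ℝ) :
    Set (PWCoord k l → ℝ) := {x | ∃ t ∈ B, planeWaveChron μ m (axisPoint j t) x}

/-- The chronological past of the part of the `z_j`-axis over `B`. -/
def axisPast (μ : Fin k → ℝ) (m : Fin l → ℝ) (j : Fin k ⊕ Fin l) (B : Set ℝ) :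
    Set (PWCoord k l → ℝ) := {x | ∃ t ∈ B, planeWaveChron μ m x (axisPoint j t)}

lemma preimage_axisPast (B : Set ℝ) :
    timeReversal ⁻¹' axisPast μ m j B = axisFuture μ m j B := by
  ext x
  refine exists_congr fun t => and_congr_right fun _ => ?_
  rw [← timeReversal_axisPoint t, chron_timeReversal_iff, timeReversal_axisPoint]

lemma preimage_axisFuture (B : Set ℝ) :
    timeReversal ⁻¹' axisFuture μ m j B = axisPast μ m j B := by
  rw [← preimage_axisPast, preimage_preimage_of_involutive timeReversal_timeReversal]

/-- The points `(u, 0, 0)` with `0 < u < w` are not in the future of the axis: a suitable `V`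
vanishes both there and on the axis, yet would have to increase. -/
lemma le_of_upper_subset_axisFuture (hν : 0 < ν) (hle : ∀ s, freq μ m s ≤ ν ^ 2) {w : ℝ}
    (hw0 : 0 < w) (hw : w < Real.pi / ν) (hj : ∀ u ∈ Icc 0 w, 0 < gcos (freq μ m j) u)
    {B : Set ℝ} {c : ℝ} (h : upper k l c ⊆ axisFuture μ m j B) : w ≤ c := by
  by_contra! hc
  obtain ⟨u, hu, huw⟩ := exists_between (max_lt hc hw0)
  obtain ⟨t, -, ht⟩ := h (show pt u 0 0 ∈ upper k l c from (le_max_left _ _).trans_lt hu)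
  -- Mode `j` must be centred at `0` so that `V` vanishes along the axis. The other coordinates are
  -- zero there, so their modes can be centred at the midpoint, which keeps them regular on all of
  -- `[0, w]`.
  set cen : Fin k ⊕ Fin l → ℝ := fun s => if s = j then 0 else w / 2 with hcen
  have key := chron_rosen_lt ht (a := 0) (b := w) (c := cen) le_rfl huw.le (fun s x hx => ?_) 0
  · have h1 : rosenV (freq μ m) cen (pt u 0 0) = 0 := by simp [rosenV]
    have h2 : rosenV (freq μ m) cen (axisPoint j t) = 0 := by
      simp only [rosenV, axisPoint, pt_one, pt_zero, pt_inr, zero_add]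
      rw [Finset.sum_eq_zero, mul_zero]
      intro s _
      by_cases hs : s = j
      · simp [hcen, hs]
      · simp [hs]
    rw [h1, h2] at key
    simp at key
  · by_cases hs : s = j
    · subst hs
      simpa [hcen] using hj x hx
    · simp only [hcen, hs, if_false]
      refine gcos_pos hν (hle s) ?_
      have e : Real.pi / (2 * ν) = Real.pi / ν / 2 := by field_simp
      rw [e, abs_lt]
      constructor <;> linarith [hx.1, hx.2]

lemma xplus_nonneg_of_subset {B : Set ℝ} {p : PWCoord k l → ℝ}
    (h : chronFuture (planeWaveChron μ m) {p} ⊆ axisFuture μ m j B) : 0 ≤ p (Sum.inl 0) := by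
  obtain ⟨K, hK⟩ := exists_slope μ m p
  refine le_of_forall_pos_lt_add fun ε hε => ?_
  obtain ⟨t, -, ht⟩ := h (mem_chronFuture_singleton.2 (chron_add_pt p hK hε))
  simpa [axisPoint] using chron_xplus_lt ht

/-- Approach `p` from its future by points lying above axis points `t ε`. The Rosen inequality
forces `V ≥ 0` in the limit. If `V` tends to `0`, then `(ΔZ)² ≤ 2 V T` tends to `0`, so the axis
points converge to `p`. -/
lemma axis_of_subset (hν : 0 < ν) (hle : ∀ s, freq μ m s ≤ ν ^ 2) {B : Set ℝ}
    {p : PWCoord k l → ℝ} (h : chronFuture (planeWaveChron μ m) {p} ⊆ axisFuture μ m j B)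
    (h0 : p (Sum.inl 0) = 0) :
    0 ≤ p (Sum.inl 1) ∧
      (IsClosed B → p (Sum.inl 1) = 0 → ∃ t ∈ B, p = axisPoint j t) := by
  obtain ⟨K, hK⟩ := exists_slope μ m p
  have hmem (ε : ℝ) (hε : 0 < ε) :
      ∃ t ∈ B, planeWaveChron μ m (axisPoint j t) (p + pt ε (K * ε) 0) :=
    h (mem_chronFuture_singleton.2 (chron_add_pt p hK hε))
  choose! t htB ht using hmem
  have hr0 : 0 < Real.pi / (2 * ν) := by have := Real.pi_pos; positivity
  set lam := freq μ m with hlam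
  have hgc {s x} (hx : |x| < Real.pi / (2 * ν)) :
      0 < gcos (lam s) (x - (0 : Fin k ⊕ Fin l → ℝ) s) := by
    simpa using gcos_pos hν (hle s) hx
  have hev : ∀ᶠ ε in 𝓝[>] (0 : ℝ), 0 < ε ∧ ε < Real.pi / (2 * ν) := Ioo_mem_nhdsGT hr0
  have hqt : Tendsto (fun ε : ℝ => p + pt ε (K * ε) 0) (𝓝[>] 0) (𝓝 p) :=
    (tendsto_add_pt p K).mono_left nhdsWithin_le_nhds
  have hqi (x) : Tendsto (fun ε : ℝ => (p + pt ε (K * ε) 0 : PWCoord k l → ℝ) x) (𝓝[>] 0)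
      (𝓝 (p x)) :=
    ((continuous_apply x).tendsto p).comp hqt
  have hT (s) : Tendsto (fun ε : ℝ => rosenT lam 0 (p + pt ε (K * ε) 0) s) (𝓝[>] 0) (𝓝 0) := by
    have h1 : ContinuousAt (gtan (lam s)) 0 :=
      (hasDerivAt_gtan (lam := lam s) (u := 0) (by simp)).continuousAt
    have h2 := hqi (Sum.inl 0)
    rw [h0] at h2
    have h3 := h1.tendsto.comp h2
    rw [gtan_zero] at h3
    refine h3.congr fun ε => ?_
    simp [rosenT]
  have hVt : Tendsto (fun ε : ℝ => rosenV lam 0 (p + pt ε (K * ε) 0)) (𝓝[>] 0)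
      (𝓝 (p (Sum.inl 1))) := by
    have h1 := (hqi (Sum.inl 1)).add ((tendsto_finsetSum Finset.univ fun s _ =>
      ((hT s).const_mul (lam s)).mul ((hqi (Sum.inr s)).pow 2)).const_mul (1 / 2))
    simp only [mul_zero, zero_mul, Finset.sum_const_zero, add_zero] at h1
    exact h1
  have hZt (s) : Tendsto (fun ε : ℝ => rosenZ lam 0 (p + pt ε (K * ε) 0) s) (𝓝[>] 0)
      (𝓝 (p (Sum.inr s))) := by
    have h2 := hqi (Sum.inl 0)
    rw [h0] at h2
    have h3 := ((continuous_gcos (lam s)).tendsto 0).comp h2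
    rw [gcos_zero] at h3
    have h4 := (hqi (Sum.inr s)).div h3 one_ne_zero
    rw [div_one] at h4
    refine h4.congr fun ε => ?_
    simp [rosenZ]
  have hVa (x : ℝ) : rosenV lam 0 (axisPoint j x) = 0 := by simp [rosenV, axisPoint]
  have hTa (x : ℝ) (s) : rosenT lam 0 (axisPoint j x) s = 0 := by simp [rosenT, axisPoint]
  have hZa (x : ℝ) (s) :
      rosenZ lam 0 (axisPoint j x) s = (Pi.single j x : Fin k ⊕ Fin l → ℝ) s := by
    simp [rosenZ, axisPoint]
  have hcen {ε : ℝ} (hε : 0 < ε ∧ ε < Real.pi / (2 * ν)) (s u)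
      (hu : u ∈ Icc ((axisPoint j (t ε) : PWCoord k l → ℝ) (Sum.inl 0))
        ((p + pt ε (K * ε) 0 : PWCoord k l → ℝ) (Sum.inl 0))) :
      0 < gcos (lam s) (u - (0 : Fin k ⊕ Fin l → ℝ) s) := by
    simp only [axisPoint, pt_zero, Pi.add_apply, h0, zero_add] at hu
    refine hgc ?_
    rw [abs_of_nonneg hu.1]
    exact hu.2.trans_lt hε.2
  have hlt {ε : ℝ} (hε : 0 < ε ∧ ε < Real.pi / (2 * ν)) :
      rosenQ lam 0 (axisPoint j (t ε)) (p + pt ε (K * ε) 0)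
        < 2 * rosenV lam 0 (p + pt ε (K * ε) 0) := by
    have := rosenQ_lt_of_chron (ht ε hε.1) (hcen hε)
    rwa [hVa, sub_zero] at this
  refine ⟨ge_of_tendsto hVt ?_, fun hB h1 => ?_⟩
  · filter_upwards [hev] with ε hε
    have h1 := hlt hε
    have h2 := rosenQ_nonneg (lam := lam) (chron_xplus_lt (ht ε hε.1)) (hcen hε)
    linarith
  · rw [h1] at hVt
    have hsq (s) : Tendsto (fun ε : ℝ => rosenZ lam 0 (p + pt ε (K * ε) 0) s
        - (Pi.single j (t ε) : Fin k ⊕ Fin l → ℝ) s) (𝓝[>] 0) (𝓝 0) := by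
      have h2 : Tendsto (fun ε : ℝ => (rosenZ lam 0 (p + pt ε (K * ε) 0) s
          - (Pi.single j (t ε) : Fin k ⊕ Fin l → ℝ) s) ^ 2) (𝓝[>] 0) (𝓝 0) := by
        have h3 := (hVt.const_mul 2).mul (hT s)
        simp only [mul_zero] at h3
        refine tendsto_of_tendsto_of_tendsto_of_le_of_le' tendsto_const_nhds h3
          (Eventually.of_forall fun ε => sq_nonneg _) ?_
        filter_upwards [hev] with ε hε
        have h4 := hlt hε
        have h5 (s) := rosenT_lt (lam := lam) (chron_xplus_lt (ht ε hε.1)) (hcen hε s)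
        have h6 := (Finset.single_le_sum (f := fun s => (rosenZ lam 0 (p + pt ε (K * ε) 0) s
          - rosenZ lam 0 (axisPoint j (t ε)) s) ^ 2 / (rosenT lam 0 (p + pt ε (K * ε) 0) s
          - rosenT lam 0 (axisPoint j (t ε)) s))
          (fun s _ => div_nonneg (sq_nonneg _) (sub_nonneg.2 (h5 s).le))
          (Finset.mem_univ s)).trans h4.le
        have h7 := h5 s
        simp only [hTa, hZa, sub_zero] at h6 h7
        rwa [div_le_iff₀ h7] at h6
      have h3 := h2.sqrt
      rw [Real.sqrt_zero] at h3
      simp only [Real.sqrt_sq_eq_abs] at h3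
      exact (tendsto_zero_iff_abs_tendsto_zero _).2 h3
    have hlim (s) : Tendsto (fun ε : ℝ => (Pi.single j (t ε) : Fin k ⊕ Fin l → ℝ) s) (𝓝[>] 0)
        (𝓝 (p (Sum.inr s))) := by
      have := (hZt s).sub (hsq s)
      rw [sub_zero] at this
      exact this.congr fun ε => by ring
    refine ⟨p (Sum.inr j), ?_, ext_coords (by simp [axisPoint, h0]) (by simp [axisPoint, h1])
      fun s => ?_⟩
    · have h2 := hlim j
      simp only [Pi.single_eq_same] at h2
      refine hB.mem_of_tendsto h2 ?_
      filter_upwards [hev] with ε hε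
      exact htB ε hε.1
    · by_cases hs : s = j
      · subst hs
        simp [axisPoint]
      · have h2 := hlim s
        simp only [Pi.single_apply, hs, if_false] at h2
        simp [axisPoint, hs, tendsto_nhds_unique h2 tendsto_const_nhds]

/-- The image in the completion of the part of the `z_j`-axis over `B`. -/
def axisPts (μ : Fin k → ℝ) (m : Fin l → ℝ) (j : Fin k ⊕ Fin l) (B : Set ℝ) :
    Set (CausalCompletion (planeWaveChron μ m)) :=
  pts (planeWaveChron μ m) (axisPoint j '' B)

lemma mem_axisPts {B : Set ℝ} {Q : CausalCompletion (planeWaveChron μ m)} :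
    Q ∈ axisPts μ m j B ↔ ∃ t ∈ B, Q.Represents (axisPoint j t) := by
  simp [axisPts, pts]

lemma mem_axisPts_of_future (hν : 0 < ν) (hle : ∀ s, freq μ m s ≤ ν ^ 2)
    (hi : freq μ m i = ν ^ 2) (hj : freq μ m j < ν ^ 2) {B : Set ℝ} (hB : IsClosed B)
    {Q : CausalCompletion (planeWaveChron μ m)} (hne : Q.future.Nonempty)
    (hF : Q.future ⊆ axisFuture μ m j B) (hP : Q.past ⊆ axisPast μ m j B) :
    Q ∈ axisPts μ m j B := by
  have hP' : timeReversal ⁻¹' Q.past ⊆ axisFuture μ m j B := by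
    rw [← preimage_axisPast]
    exact preimage_mono hP
  have hIF := isIF_future hne
  rw [← isIP_preimage timeReversal_timeReversal fun _ _ => chron_timeReversal_iff] at hIF
  -- The future of the axis lies in `x⁺ > 0`, which is the bound needed to apply the classification
  -- to the time-reversed IF.
  have hbd : timeReversal ⁻¹' Q.future ⊆ lower k l 0 := by
    rw [← neg_zero, ← preimage_timeReversal_upper]
    refine preimage_mono fun x hx => ?_
    obtain ⟨t, -, ht⟩ := hF hx
    exact chron_xplus_lt ht
  have hback : Q.future = timeReversal ⁻¹' (timeReversal ⁻¹' Q.future) :=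
    (preimage_preimage_of_involutive timeReversal_timeReversal _).symm
  rcases isIP_eq_of_bounded hν hle hi hIF hbd with ⟨p, hp⟩ | ⟨c, hc⟩
  · rw [hp, preimage_timeReversal_chronPast] at hback
    set q := timeReversal p
    have hpast : Q.past = chronPast (planeWaveChron μ m) {q} :=
      past_eq hne (hback ▸ sRelated_point q) (hback ▸ commonPast_chronFuture q)
    rw [hback] at hF
    rw [hpast, preimage_timeReversal_chronPast] at hP'
    have h1 := xplus_nonneg_of_subset hF
    have h2 := xplus_nonneg_of_subset hP'
    simp only [timeReversal, pt_zero, Left.nonneg_neg_iff] at h2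
    have h0 := le_antisymm h2 h1
    obtain ⟨h3, h4⟩ := axis_of_subset hν hle hF h0
    obtain ⟨h5, -⟩ := axis_of_subset hν hle hP' (by simp [timeReversal, h0])
    simp only [timeReversal, pt_one, Left.nonneg_neg_iff] at h5
    obtain ⟨t, ht, hqt⟩ := h4 hB (le_antisymm h5 h3)
    exact mem_axisPts.2 ⟨t, ht, hqt ▸ hpast, hqt ▸ hback⟩
  · exfalso
    rw [hc, preimage_timeReversal_lower] at hback
    have hpast : Q.past = lower k l (-c - Real.pi / ν) :=
      past_eq hne (hback ▸ sRelated_halfSpaces hν hle hi (-c))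
        (hback ▸ commonPast_upper hν hle hi (-c))
    rw [hback] at hF
    rw [hpast, preimage_timeReversal_lower] at hP'
    obtain ⟨w, hw1, hw2, hw3⟩ := exists_gcos_pos hν hj
    have hπ : 0 < Real.pi / (2 * ν) := by have := Real.pi_pos; positivity
    have h1 := le_of_upper_subset_axisFuture hν hle (hπ.trans hw1) hw2 hw3 hF
    have h2 := le_of_upper_subset_axisFuture hν hle (hπ.trans hw1) hw2 hw3 hP'
    have e : Real.pi / (2 * ν) = Real.pi / ν / 2 := by field_simp
    rw [e] at hw1
    linarith

lemma mem_axisPts_of_past (hν : 0 < ν) (hle : ∀ s, freq μ m s ≤ ν ^ 2)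
    (hi : freq μ m i = ν ^ 2) (hj : freq μ m j < ν ^ 2) {B : Set ℝ} (hB : IsClosed B)
    {Q : CausalCompletion (planeWaveChron μ m)} (hne : Q.past.Nonempty)
    (hF : Q.future ⊆ axisFuture μ m j B) (hP : Q.past ⊆ axisPast μ m j B) :
    Q ∈ axisPts μ m j B := by
  have hs : Function.Surjective (timeReversal (k := k) (l := l)) :=
    Function.RightInverse.surjective timeReversal_timeReversal
  have key := mem_axisPts_of_future hν hle hi hj hB
    (Q := Q.reverse timeReversal_timeReversal fun _ _ => chron_timeReversal_iff)
    (hne.preimage hs)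
    (by rw [← preimage_axisPast]; exact preimage_mono hP)
    (by rw [← preimage_axisFuture]; exact preimage_mono hF)
  rw [mem_axisPts] at key ⊢
  obtain ⟨t, ht, h1, h2⟩ := key
  refine ⟨t, ht, ?_, ?_⟩
  · rw [← preimage_preimage_of_involutive timeReversal_timeReversal Q.past]
    refine (congrArg (timeReversal ⁻¹' ·) h2).trans ?_
    rw [preimage_timeReversal_chronFuture, timeReversal_axisPoint]
  · rw [← preimage_preimage_of_involutive timeReversal_timeReversal Q.future]
    refine (congrArg (timeReversal ⁻¹' ·) h1).trans ?_
    rw [preimage_timeReversal_chronPast, timeReversal_axisPoint]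

/-- Allowing any closed part `B` of the axis, not just the whole line, shows that the image of `B`
is closed in the completion; the accumulation statement rests on this. -/
lemma Lplus_inter_Lminus_axisPts (hν : 0 < ν) (hle : ∀ s, freq μ m s ≤ ν ^ 2)
    (hi : freq μ m i = ν ^ 2) (hj : freq μ m j < ν ^ 2) {B : Set ℝ} (hB : IsClosed B) :
    Lplus (axisPts μ m j B) ∩ Lminus (axisPts μ m j B) ⊆ axisPts μ m j B := by
  have hfut : ⋃ Q ∈ axisPts μ m j B, Q.future ⊆ axisFuture μ m j B := by
    refine iUnion₂_subset fun Q hQ x hx => ?_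
    obtain ⟨t, ht, -, h⟩ := mem_axisPts.1 hQ
    rw [h] at hx
    exact ⟨t, ht, mem_chronFuture_singleton.1 hx⟩
  have hpast : ⋃ Q ∈ axisPts μ m j B, Q.past ⊆ axisPast μ m j B := by
    refine iUnion₂_subset fun Q hQ x hx => ?_
    obtain ⟨t, ht, h, -⟩ := mem_axisPts.1 hQ
    rw [h] at hx
    exact ⟨t, ht, mem_chronPast_singleton.1 hx⟩
  -- A point adjoined by a boundary closure has an empty component, for which the required inclusion
  -- is trivial; both components cannot be empty. The approximating sequences play no role.
  rintro Q ⟨(hQ | hQ) | ⟨hQ, -⟩, (hQ' | hQ') | ⟨hQ', -⟩⟩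
  · exact hQ
  · exact hQ
  · exact hQ
  · exact hQ'
  · exact mem_axisPts_of_future hν hle hi hj hB hQ.1 (hQ.2.trans hfut) (hQ'.2.trans hpast)
  · exact mem_axisPts_of_future hν hle hi hj hB hQ.1 (hQ.2.trans hfut)
      (by rw [hQ']; exact empty_subset _)
  · exact hQ'
  · exact mem_axisPts_of_past hν hle hi hj hB hQ'.1 (by rw [hQ]; exact empty_subset _)
      (hQ'.2.trans hpast)
  · rcases Q.past_nonempty_or_future_nonempty with h | h
    · rw [hQ'] at h
      exact absurd rfl h.ne_empty
    · rw [hQ] at h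
      exact absurd rfl h.ne_empty

lemma not_accPt_axisPts (hν : 0 < ν) (hle : ∀ s, freq μ m s ≤ ν ^ 2)
    (hi : freq μ m i = ν ^ 2) (hj : freq μ m j < ν ^ 2) {A : Set ℝ}
    (hA : ∀ t : ℝ, ¬ AccPt t (𝓟 A)) (Q : CausalCompletion (planeWaveChron μ m)) :
    ¬ AccPt Q (𝓟 (axisPts μ m j A)) := by
  intro hacc
  -- Discarding the parameters that represent `Q` leaves a set still without accumulation points,
  -- hence closed, whose image avoids `Q`.
  set B : Set ℝ := {t | t ∈ A ∧ ¬ Q.Represents (axisPoint j t)} with hBdef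
  have hB : IsClosed B := by
    rw [isClosed_iff_derivedSet_subset]
    intro t ht
    exact absurd (AccPt.mono ht (principal_mono.2 fun x hx => hx.1)) (hA t)
  have hQB : Q ∉ Lplus (axisPts μ m j B) ∩ Lminus (axisPts μ m j B) := fun h => by
    obtain ⟨t, ht, h'⟩ := mem_axisPts.1 (Lplus_inter_Lminus_axisPts hν hle hi hj hB h)
    exact ht.2 h'
  have hopen := ((isClosed_Lplus (axisPts μ m j B)).inter
    (isClosed_Lminus (axisPts μ m j B))).isOpen_compl
  obtain ⟨Q', ⟨hQ', hQA⟩, hne⟩ := accPt_iff_nhds.1 hacc _ (hopen.mem_nhds hQB)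
  obtain ⟨t, ht, hrep⟩ := mem_axisPts.1 hQA
  by_cases hQt : Q.Represents (axisPoint j t)
  · exact hne (ext_sets (hrep.1.trans hQt.1.symm) (hrep.2.trans hQt.2.symm))
  · have : Q' ∈ axisPts μ m j B := mem_axisPts.2 ⟨t, ⟨ht, hQt⟩, hrep⟩
    exact hQ' ⟨subset_Lplus _ this, subset_Lminus _ this⟩

lemma infinite_axisPts (hν : 0 < ν) (hle : ∀ s, freq μ m s ≤ ν ^ 2) {A : Set ℝ}
    (hA : A.Infinite) : (axisPts μ m j A).Infinite := by
  have h := hA.image (f := fun t => (⟨_, _, Or.inl (sRelated_point (axisPoint j t))⟩ :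
    CausalCompletion (planeWaveChron μ m))) ?_
  · refine h.mono ?_
    rintro _ ⟨t, ht, rfl⟩
    exact mem_axisPts.2 ⟨t, ht, rfl, rfl⟩
  · intro t _ t' _ htt'
    have hfut : chronFuture (planeWaveChron μ m) {axisPoint j t}
        = chronFuture (planeWaveChron μ m) {axisPoint j t'} :=
      congrArg CausalCompletion.future htt'
    have hsub : chronFuture (planeWaveChron μ m) {axisPoint j t} ⊆ axisFuture μ m j {t'} := by
      rw [hfut]
      exact fun x hx => ⟨t', rfl, mem_chronFuture_singleton.1 hx⟩
    -- Distinct axis points have distinct futures, by the rigidity statement for the singleton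
    -- `{t'}`.
    obtain ⟨s, rfl, hs⟩ := (axis_of_subset hν hle hsub rfl).2 isClosed_singleton rfl
    simpa [axisPoint] using congrFun hs (Sum.inr j)

lemma not_compactSpace (hν : 0 < ν) (hle : ∀ s, freq μ m s ≤ ν ^ 2)
    (hi : freq μ m i = ν ^ 2) (hj : freq μ m j < ν ^ 2) :
    ¬ CompactSpace (CausalCompletion (planeWaveChron μ m)) := by
  intro hcomp
  have hinf : (range ((↑) : ℕ → ℝ)).Infinite := infinite_range_of_injective Nat.cast_injective
  obtain ⟨Q, hQ⟩ := (infinite_axisPts (j := j) hν hle hinf).exists_accPt_principal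
  refine not_accPt_axisPts hν hle hi hj (fun t ht => ?_) Q hQ
  have h1 := isClosed_and_discrete_iff.1 ⟨Nat.isClosedEmbedding_coe_real.isClosed_range,
    Nat.isClosedEmbedding_coe_real.isDiscrete_range⟩ t
  exact ht.ne (disjoint_iff.1 h1)

end PlaneWave

/-! ## Curvature and conformal flatness -/

namespace PlaneWave

variable {k l : ℕ} {μ : Fin k → ℝ} {m : Fin l → ℝ}

lemma contDiff_gsin (lam : ℝ) : ContDiff ℝ ∞ (gsin lam) := by
  unfold gsin
  split_ifs
  · exact (Real.contDiff_sin.comp (contDiff_const.mul contDiff_id)).div_const _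
  · exact contDiff_id
  · exact (Real.contDiff_sinh.comp (contDiff_const.mul contDiff_id)).div_const _

lemma contDiff_gcos (lam : ℝ) : ContDiff ℝ ∞ (gcos lam) := by
  unfold gcos
  split_ifs
  · exact Real.contDiff_cos.comp (contDiff_const.mul contDiff_id)
  · exact contDiff_const
  · exact Real.contDiff_cosh.comp (contDiff_const.mul contDiff_id)

/-- If all frequencies agree, Rosen coordinates are conformally flat. -/
lemma locallyConformalTo_of_freq_eq {lam : ℝ} (h : ∀ s, freq μ m s = lam) :
    (planeWave μ m).LocallyConformalTo (minkowski k l) := by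
  intro p
  set c := p (Sum.inl 0) with hc
  set cen : Fin k ⊕ Fin l → ℝ := fun _ => c with hcen
  -- With one common factor `C = gcos`, the Rosen form `-2 dx⁺ dV + C² ∑ dZ²` equals `C² (-2 dT dV +
  -- ∑ dZ²)`, since `dT = dx⁺ / C²`. So `(T, V, Z)` is conformal with factor `C`.
  set φ : (PWCoord k l → ℝ) → (PWCoord k l → ℝ) := fun x =>
    pt (gtan lam (x (Sum.inl 0) - c)) (rosenV (freq μ m) cen x) (rosenZ (freq μ m) cen x) with hφ
  set U : Set (PWCoord k l → ℝ) := {x | 0 < gcos lam (x (Sum.inl 0) - c)} with hU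
  have hsub : ContDiff ℝ ∞ fun x : PWCoord k l → ℝ => x (Sum.inl 0) - c :=
    (contDiff_apply ℝ ℝ (Sum.inl 0)).sub contDiff_const
  have hC : ContDiff ℝ ∞ fun x : PWCoord k l → ℝ => gcos lam (x (Sum.inl 0) - c) :=
    (contDiff_gcos lam).comp hsub
  have hS : ContDiff ℝ ∞ fun x : PWCoord k l → ℝ => gsin lam (x (Sum.inl 0) - c) :=
    (contDiff_gsin lam).comp hsub
  have hT : ContDiffOn ℝ ∞ (fun x : PWCoord k l → ℝ => gtan lam (x (Sum.inl 0) - c)) U :=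
    hS.contDiffOn.div hC.contDiffOn fun x hx => ne_of_gt hx
  have hUo : IsOpen U := isOpen_lt continuous_const hC.continuous
  have hφU : ContDiffOn ℝ ∞ φ U := by
    rw [contDiffOn_pi, forall_coord]
    refine ⟨hT, ?_, fun s => ?_⟩
    · simp only [hφ, pt_one, rosenV, h, hcen]
      refine (contDiff_apply ℝ ℝ (Sum.inl 1)).contDiffOn.add (contDiffOn_const.mul
        (ContDiffOn.sum fun s _ => (contDiffOn_const.mul hT).mul
          ((contDiff_apply ℝ ℝ (Sum.inr s)).contDiffOn.pow 2)))
    · simp only [hφ, pt_inr, rosenZ, h, hcen]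
      exact (contDiff_apply ℝ ℝ (Sum.inr s)).contDiffOn.div hC.contDiffOn fun x hx => ne_of_gt hx
  refine ⟨U, φ, fun x => gcos lam (x (Sum.inl 0) - c), hUo, by simp [hU, hc], hφU,
    hC.contDiffOn, fun x hx => ⟨hx, fun v w => ?_⟩⟩
  have hx0 : gcos lam (x (Sum.inl 0) - c) ≠ 0 := ne_of_gt hx
  have hdiff : DifferentiableAt ℝ φ x :=
    (hφU.contDiffAt (hUo.mem_nhds hx)).differentiableAt (by simp)
  set D : (PWCoord k l → ℝ) → PWCoord k l → ℝ := fun v =>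
    pt (1 / gcos lam (x (Sum.inl 0) - c) ^ 2 * v (Sum.inl 0))
      (v (Sum.inl 1) + 1 / 2 * ∑ s, (lam * (1 / gcos lam (x (Sum.inl 0) - c) ^ 2 * v (Sum.inl 0))
        * x (Sum.inr s) ^ 2 + lam * gtan lam (x (Sum.inl 0) - c)
          * (2 * x (Sum.inr s) * v (Sum.inr s))))
      (fun s => (v (Sum.inr s) * gcos lam (x (Sum.inl 0) - c) - x (Sum.inr s) *
          (-lam * gsin lam (x (Sum.inl 0) - c) * v (Sum.inl 0)))
            / gcos lam (x (Sum.inl 0) - c) ^ 2) with hD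
  have hder (v : PWCoord k l → ℝ) : fderiv ℝ φ x v = D v := by
    rw [← hdiff.lineDeriv_eq_fderiv]
    refine HasLineDerivAt.lineDeriv ?_
    have hlin (i) : HasDerivAt (fun t : ℝ => (x + t • v) i) (v i) 0 := by
      simpa using ((hasDerivAt_id (0 : ℝ)).mul_const (v i)).const_add (x i)
    have hx' : (x + (0 : ℝ) • v) (Sum.inl 0) - c = x (Sum.inl 0) - c := by simp
    have h1 : HasDerivAt (fun t : ℝ => gtan lam ((x + t • v) (Sum.inl 0) - c))
        (1 / gcos lam (x (Sum.inl 0) - c) ^ 2 * v (Sum.inl 0)) 0 := by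
      have := HasDerivAt.comp (h₂ := gtan lam) (0 : ℝ)
        (hasDerivAt_gtan (lam := lam) (by rw [hx']; exact hx0)) ((hlin (Sum.inl 0)).sub_const c)
      rwa [hx'] at this
    have h2 : HasDerivAt (fun t : ℝ => gcos lam ((x + t • v) (Sum.inl 0) - c))
        (-lam * gsin lam (x (Sum.inl 0) - c) * v (Sum.inl 0)) 0 := by
      have := HasDerivAt.comp (h₂ := gcos lam) (0 : ℝ) (hasDerivAt_gcos lam _)
        ((hlin (Sum.inl 0)).sub_const c)
      rwa [hx'] at this
    refine hasDerivAt_pi.2 ?_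
    rw [forall_coord]
    refine ⟨h1, ?_, fun s => ?_⟩
    · simp only [hφ, pt_one, rosenV, h, hcen, hD]
      refine (hlin (Sum.inl 1)).add ((HasDerivAt.fun_sum fun s _ => ?_).const_mul (1 / 2))
      refine ((h1.const_mul lam).mul ((hlin (Sum.inr s)).pow 2)).congr_deriv ?_
      simp
    · simp only [hφ, pt_inr, rosenZ, h, hcen, hD]
      refine ((hlin (Sum.inr s)).div h2 (by rwa [hx'])).congr_deriv ?_
      simp
  rw [hder, hder, pair_planeWave, pair_minkowski, pwPotential_eq]
  simp only [hD, pt_zero, pt_one, pt_inr, h, gtan]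
  set C := gcos lam (x (Sum.inl 0) - c)
  set S := gsin lam (x (Sum.inl 0) - c)
  have hCS : C ^ 2 + lam * S ^ 2 = 1 := gcos_sq_add _ _
  have hterm (s : Fin k ⊕ Fin l) : v (Sum.inr s) * w (Sum.inr s)
      = lam * x (Sum.inr s) ^ 2 * (v (Sum.inl 0) * w (Sum.inl 0))
      - 1 / 2 * v (Sum.inl 0) * (lam * (1 / C ^ 2 * w (Sum.inl 0)) * x (Sum.inr s) ^ 2
        + lam * (S / C) * (2 * x (Sum.inr s) * w (Sum.inr s)))
      - 1 / 2 * w (Sum.inl 0) * (lam * (1 / C ^ 2 * v (Sum.inl 0)) * x (Sum.inr s) ^ 2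
        + lam * (S / C) * (2 * x (Sum.inr s) * v (Sum.inr s)))
      + C ^ 2 * ((v (Sum.inr s) * C - x (Sum.inr s) * (-lam * S * v (Sum.inl 0))) / C ^ 2
        * ((w (Sum.inr s) * C - x (Sum.inr s) * (-lam * S * w (Sum.inl 0))) / C ^ 2)) := by
    field_simp
    linear_combination (-(2 * lam * x (Sum.inr s) ^ 2 * v (Sum.inl 0) * w (Sum.inl 0))) * hCS
  rw [Finset.sum_congr rfl fun s _ => hterm s]
  simp only [Finset.sum_add_distrib, Finset.sum_sub_distrib, ← Finset.mul_sum, ← Finset.sum_mul]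
  field_simp
  ring

/-! ### The Ricci tensor -/

lemma planeWave_inv (p : PWCoord k l → ℝ) :
    (planeWave μ m p)⁻¹ = Matrix.fromBlocks !![0, -1; -1, pwPotential μ m p] 0 0 1 := by
  have h2 : (!![-pwPotential μ m p, -1; -1, 0] : Matrix (Fin 2) (Fin 2) ℝ)
      * !![0, -1; -1, pwPotential μ m p] = 1 := by
    ext a b
    fin_cases a <;> fin_cases b <;> simp
  have h : planeWave μ m p * Matrix.fromBlocks !![0, -1; -1, pwPotential μ m p] 0 0 1 = 1 := by
    rw [planeWave, Matrix.fromBlocks_multiply]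
    simp only [Matrix.mul_zero, Matrix.zero_mul, add_zero, zero_add, Matrix.mul_one, h2,
      Matrix.fromBlocks_one]
  exact Matrix.inv_eq_right_inv h

lemma partialDeriv_pwPotential (b : PWCoord k l) (p : PWCoord k l → ℝ) :
    partialDeriv b (pwPotential μ m) p
      = Sum.elim (fun _ => 0) (fun s => 2 * freq μ m s * p (Sum.inr s)) b := by
  have e : pwPotential μ m = fun p => ∑ s, freq μ m s * p (Sum.inr s) ^ 2 :=
    funext pwPotential_eq
  have hd : DifferentiableAt ℝ (fun p : PWCoord k l → ℝ => ∑ s, freq μ m s * p (Sum.inr s) ^ 2) p :=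
    by fun_prop
  rw [e, partialDeriv, ← hd.lineDeriv_eq_fderiv]
  refine HasLineDerivAt.lineDeriv ?_
  have hlin (i) : HasDerivAt (fun t : ℝ => (p + t • (Pi.single b 1 : PWCoord k l → ℝ)) i)
      ((Pi.single b 1 : PWCoord k l → ℝ) i) 0 := by
    simpa using ((hasDerivAt_id (0 : ℝ)).mul_const
      ((Pi.single b 1 : PWCoord k l → ℝ) i)).const_add (p i)
  refine (HasDerivAt.fun_sum fun s _ =>
    ((hlin (Sum.inr s)).pow 2).const_mul (freq μ m s)).congr_deriv ?_
  rcases b with b | b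
  · refine Finset.sum_eq_zero fun s _ => ?_
    simp
  · rw [Finset.sum_eq_single b]
    · simp
      ring
    · intro s _ hs
      simp [hs]
    · simp

lemma partialDeriv_planeWave (b d c : PWCoord k l) (p : PWCoord k l → ℝ) :
    partialDeriv b (fun x => planeWave μ m x d c) p
      = if d = Sum.inl 0 ∧ c = Sum.inl 0 then -partialDeriv b (pwPotential μ m) p else 0 := by
  have hconst {f : (PWCoord k l → ℝ) → ℝ} {r : ℝ} (h : f = fun _ => r) :
      partialDeriv b f p = 0 := by simp [h, partialDeriv]
  rcases d with d | d <;> rcases c with c | c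
  · fin_cases d <;> fin_cases c
    · simp only [planeWave, Matrix.fromBlocks_apply₁₁]
      simp [partialDeriv]
    all_goals
      simp only [planeWave, Matrix.fromBlocks_apply₁₁]
      simp [partialDeriv]
  · simpa using hconst (r := 0) (by funext x; simp [planeWave])
  · simpa using hconst (r := 0) (by funext x; simp [planeWave])
  · simpa using hconst (r := (1 : Matrix (Fin k ⊕ Fin l) (Fin k ⊕ Fin l) ℝ) d c)
      (by funext x; simp [planeWave])

lemma partialDeriv_planeWave_zero (b d c : PWCoord k l) :
    partialDeriv b (fun x => planeWave μ m x d c) 0 = 0 := by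
  rw [partialDeriv_planeWave, partialDeriv_pwPotential]
  rcases b with b | b <;> simp

lemma christoffel_zero (a b c : PWCoord k l) : (planeWave μ m).christoffel a b c 0 = 0 := by
  simp only [MetricField.christoffel, partialDeriv_planeWave_zero]
  simp

lemma christoffel_plus_plus (a : PWCoord k l) (p : PWCoord k l → ℝ) :
    (planeWave μ m).christoffel a (Sum.inl 0) (Sum.inl 0) p
      = Sum.elim (fun _ => 0) (fun s => freq μ m s * p (Sum.inr s)) a := by
  simp only [MetricField.christoffel, partialDeriv_planeWave, partialDeriv_pwPotential,
    planeWave_inv]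
  rw [Fintype.sum_sum_type]
  rcases a with a | a
  · simp
  · simp only [Matrix.fromBlocks_apply₂₁, Matrix.fromBlocks_apply₂₂, Matrix.one_apply]
    rw [Finset.sum_eq_zero (by simp), Finset.sum_eq_single a]
    · simp
      ring
    · intro s _ hs
      simp [hs.symm]
    · simp

lemma christoffel_plus_trace (a : PWCoord k l) (p : PWCoord k l → ℝ) :
    (planeWave μ m).christoffel a (Sum.inl 0) a p = 0 := by
  simp only [MetricField.christoffel, partialDeriv_planeWave, partialDeriv_pwPotential,
    planeWave_inv]
  rw [Fintype.sum_sum_type]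
  rcases a with a | a
  · fin_cases a <;> simp
  · rw [Finset.sum_eq_zero (by simp), Finset.sum_eq_zero (by simp)]
    simp

/-- At the origin all Christoffel symbols vanish, so only derivative terms survive. The traces
`Γ^a_{+a}` vanish identically, which leaves the divergence of `Γ^s_{++} = freq s * z_s`. -/
lemma ricci_plus_plus_zero :
    (planeWave μ m).ricci (Sum.inl 0) (Sum.inl 0) 0 = ∑ s, freq μ m s := by
  have h1 (a : PWCoord k l) :
      (planeWave μ m).christoffel a (Sum.inl 0) a = fun _ => 0 :=
    funext fun p => christoffel_plus_trace a p
  have h2 (a : PWCoord k l) : (planeWave μ m).christoffel a (Sum.inl 0) (Sum.inl 0)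
      = fun p => Sum.elim (fun _ => 0) (fun s => freq μ m s * p (Sum.inr s)) a :=
    funext fun p => christoffel_plus_plus a p
  have h3 (s : Fin k ⊕ Fin l) (p : PWCoord k l → ℝ) : partialDeriv (Sum.inr s)
      (fun p : PWCoord k l → ℝ => freq μ m s * p (Sum.inr s)) p = freq μ m s := by
    have := ((hasFDerivAt_apply (𝕜 := ℝ) (F' := fun _ : PWCoord k l => ℝ)
      (Sum.inr s : PWCoord k l) p)).const_mul (freq μ m s)
    rw [partialDeriv, this.fderiv]
    simp
  have h4 (b : PWCoord k l) (p : PWCoord k l → ℝ) :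
      partialDeriv b (fun _ : PWCoord k l → ℝ => (0 : ℝ)) p = 0 := by simp [partialDeriv]
  simp only [MetricField.ricci, christoffel_zero, h1, h2, h4]
  rw [Fintype.sum_sum_type]
  simp only [Sum.elim_inl, Sum.elim_inr, h3, h4]
  simp

/-- The potential vanishes at the origin, so `∂/∂x⁺` is null there and can be used as a test vector.
-/
lemma sum_freq_nonneg (h : (planeWave μ m).NullConvergence) : 0 ≤ ∑ s, freq μ m s := by
  have h1 := h 0 (Pi.single (Sum.inl 0) 1) (by
    rw [pair_planeWave, pwPotential_eq]
    simp)
  rw [← ricci_plus_plus_zero]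
  refine h1.trans_eq ?_
  rw [Finset.sum_eq_single (Sum.inl 0), Finset.sum_eq_single (Sum.inl 0)]
  · simp
  · intro c _ hc
    simp [hc]
  · simp
  · intro b _ hb
    simp [Pi.single_apply, hb]
  · simp

/-- Otherwise a positive frequency would be equal to all the others, or no frequency would be
positive and the nonnegative sum would make them all zero. Both cases are conformally flat. -/
lemma exists_freq_lt (hnull : (planeWave μ m).NullConvergence)
    (hconf : ¬ (planeWave μ m).LocallyConformalTo (minkowski k l)) :
    ∃ i j, 0 < freq μ m i ∧ freq μ m j < freq μ m i := by
  by_contra! hcon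
  by_cases hpos : ∃ i, 0 < freq μ m i
  · obtain ⟨i, hi⟩ := hpos
    exact hconf (locallyConformalTo_of_freq_eq (lam := freq μ m i) fun s =>
      le_antisymm (hcon s i (hi.trans_le (hcon i s hi))) (hcon i s hi))
  · push Not at hpos
    have hzero := (Finset.sum_eq_zero_iff_of_nonpos fun s _ => hpos s).1
      (le_antisymm (Finset.sum_nonpos fun s _ => hpos s) (sum_freq_nonneg hnull))
    exact hconf (locallyConformalTo_of_freq_eq fun s => hzero s (Finset.mem_univ s))

lemma exists_max_freq {i j : Fin k ⊕ Fin l} (hi : 0 < freq μ m i) (hji : freq μ m j < freq μ m i) :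
    ∃ ν > 0, ∃ i', freq μ m i' = ν ^ 2 ∧ (∀ s, freq μ m s ≤ ν ^ 2) ∧ freq μ m j < ν ^ 2 := by
  obtain ⟨i', -, hi'⟩ := Finset.exists_max_image Finset.univ (freq μ m) ⟨i, Finset.mem_univ i⟩
  have hle := hi' i (Finset.mem_univ i)
  have hpos := hi.trans_le hle
  have hsq : √(freq μ m i') ^ 2 = freq μ m i' := Real.sq_sqrt hpos.le
  refine ⟨√(freq μ m i'), Real.sqrt_pos.2 hpos, i', hsq.symm, fun s => ?_, ?_⟩
  · rw [hsq]; exact hi' s (Finset.mem_univ s)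
  · rw [hsq]; exact hji.trans_le hle

end PlaneWave

open CausalCompletion in
theorem mainTheorem1 {k l : ℕ} (μ : Fin k → ℝ) (m : Fin l → ℝ) (hμ : ∀ i, 0 ≤ μ i)
    (hnull : (planeWave μ m).NullConvergence)
    (hconf : ¬ (planeWave μ m).LocallyConformalTo (minkowski k l)) :
    ¬ CompactSpace (CausalCompletion (planeWaveChron μ m)) ∧
    ∀ i j : Fin k, μ j < μ i →
      (∀ Q : CausalCompletion (planeWaveChron μ m), Q.IsIdeal →
        Q ∉ Lplus (pts (planeWaveChron μ m) (range (xAxisPoint j))) ∩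
            Lminus (pts (planeWaveChron μ m) (range (xAxisPoint j)))) ∧
      ∀ A : Set ℝ, (∀ t : ℝ, ¬ AccPt t (𝓟 A)) →
        (A.Infinite → (pts (planeWaveChron μ m) (xAxisPoint j '' A)).Infinite) ∧
        ∀ Q : CausalCompletion (planeWaveChron μ m),
          ¬ AccPt Q (𝓟 (pts (planeWaveChron μ m) (xAxisPoint j '' A))) := by
  constructor
  · obtain ⟨i, j, hi, hji⟩ := PlaneWave.exists_freq_lt hnull hconf
    obtain ⟨ν, hν, i', hi', hle, hj⟩ := PlaneWave.exists_max_freq hi hji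
    exact PlaneWave.not_compactSpace hν hle hi' hj
  · intro i j hij
    have hi : 0 < PlaneWave.freq μ m (Sum.inl i) := pow_pos ((hμ j).trans_lt hij) 2
    have hji : PlaneWave.freq μ m (Sum.inl j) < PlaneWave.freq μ m (Sum.inl i) :=
      pow_lt_pow_left₀ hij (hμ j) two_ne_zero
    obtain ⟨ν, hν, i', hi', hle, hj⟩ := PlaneWave.exists_max_freq hi hji
    have e : (xAxisPoint j : ℝ → PWCoord k l → ℝ) = PlaneWave.axisPoint (Sum.inl j) :=
      funext fun t => PlaneWave.xAxisPoint_eq j t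
    rw [e, ← image_univ]
    refine ⟨fun Q hQ hmem => ?_, fun A hA => ⟨fun hinf => ?_, fun Q => ?_⟩⟩
    · obtain ⟨p, -, hp⟩ := PlaneWave.Lplus_inter_Lminus_axisPts hν hle hi' hj isClosed_univ hmem
      exact hQ p hp
    · exact PlaneWave.infinite_axisPts hν hle hinf
    · exact PlaneWave.not_accPt_axisPts hν hle hi' hj hA Q
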